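/- Let $e\in(0,1]$, $0<\gamma\le 2$, $n\in\mathbb N$ with $n\ge 1$, and $\alpha_0\in(0,2]$. For $v,v_*\in\mathbb R^3$ and $\sigma\in\mathbb S^2$ put $$v'=\tfrac{v+v_*}{2}+\tfrac{1-e}{4}(v-v_*)+\tfrac{1+e}{4}|v-v_*|\sigma,\qquad v'_*=\tfrac{v+v_*}{2}-\tfrac{1-e}{4}(v-v_*)-\tfrac{1+e}{4}|v-v_*|\sigma .$$ Let $B(v,v_*,\sigma)=b_n(\hat v_-\cdot\sigma)\,\Phi_n(|v-v_*|)$, $\hat v_-=\frac{v-v_*}{|v-v_*|}$, be a cutoff kernel: $b_n\ge 0$ is a measurable function on $[-1,1]$ with $\int_{\mathbb S^2}b_n(k\cdot\sigma)\,d\sigma<\infty$ for unit vectors $k$ (for example $b_n=\min\{b,n\}$ for a measurable angular kernel $b\ge0$), and $\Phi_n(r)=r^\gamma\phi_c(r/n)$, where $x\mapsto\phi_c(|x|)$ belongs to $C_c^\infty(\mathbb R^3)$, $0\le\phi_c\le1$, $\phi_c(|x|)=1$ for $|x|\le1$ and $\phi_c(|x|)=0$ for $|x|>2$. For $\alpha>0$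 let $P_\alpha(\mathbb R^3)$ be the set of Borel probability measures $F$ on $\mathbb R^3$ with $\int|v|^\alpha\,dF(v)<\infty$ and, if $\alpha>1$, also $\int v_j\,dF(v)=0$ for $j=1,2,3$. Write $F\in C([0,\infty),P_\alpha(\mathbb R^3))$ if $F_t\in P_\alpha(\mathbb R^3)$ for all $t\ge0$ and $t\mapsto\int\psi\,dF_t$ is continuous on $[0,\infty)$ for every continuous $\psi:\mathbb R^3\to\mathbb R$ with $|\psi(v)|\le C(1+|v|^2)^{\alpha/2}$ for some constant $C$. Such an $F$, with $F_{t}|_{t=0}=F_0$, is a measure-valued solution in $C([0,\infty),P_\alpha(\mathbb R^3))$ with initial datum $F_0$ if for all $t\ge0$ and all $\psi\in C^2_b(\mathbb R^3)$ (bounded together with its derivatives of order at most two) $$\int\psi\,dF_t-\int\psi\,dF_0=\frac12\int_0^t\int_{\mathbb R^3}\int_{\mathbb R^3}\int_{\mathbb S^2}B(v,v_*,\sigma)\big[\psi(v')+\psi(v'_*)-\psi(v)-\psi(v_*)\big]\,d\sigma\,dF_\tau(v_*)\,dF_\tau(v)\,d\tau .$$ Then for every $F_0\in P_{\alpha_0}(\mathbb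 R^3)$ there is a family $(F^n_t)_{t\ge0}$ such that, for every $\alpha\in(0,\alpha_0)$, $F^n$ is a measure-valued solution in $C([0,\infty),P_\alpha(\mathbb R^3))$ with initial datum $F_0$, and it is the only one in $C([0,\infty),P_\alpha(\mathbb R^3))$. Moreover, if $F_0\in P_2(\mathbb R^3)$, then $\int|v|^2\,dF^n_t(v)$ is finite for all $t\ge0$ and non-increasing in $t$; in particular $\int|v|^2\,dF^n_t(v)\le\int|v|^2\,dF_0(v)$. If $F_0\in P_\beta(\mathbb R^3)$ for some $\beta\ge1$, then $v_j$ is integrable with respect to $F^n_t$ and $\int v_j\,dF^n_t(v)=\int v_j\,dF_0(v)$ for all $t\ge0$ and $j=1,2,3$. -/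

import Mathlib

open MeasureTheory Set
open scoped ContDiff

namespace InelasticBoltzmann

noncomputable section

/-- The velocity space `ℝ³` with its Euclidean norm. -/
abbrev V : Type := EuclideanSpace ℝ (Fin 3)

/-- The unit sphere `𝕊²` of `ℝ³`. -/
abbrev S2 : Type := Metric.sphere (0 : V) 1

/-- The surface measure `dσ` on `𝕊²` (of total mass `4π`). -/
def surfaceMeasure : Measure S2 := (volume : Measure V).toSphere

/-- The set `P_α(ℝ³)` of probability measures with finite moment of order `α`, which are moreover
centred when `α > 1`. -/
structure MemP (α : ℝ) (F : Measure V) : Prop where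
  isProbabilityMeasure : IsProbabilityMeasure F
  moment : Integrable (fun v : V => ‖v‖ ^ α) F
  centred : 1 < α → ∀ j : Fin 3, ∫ v : V, v j ∂F = 0

/-- `F ∈ C([0,∞), P_α(ℝ³))`: every `F t`, `t ≥ 0`, lies in `P_α`, and `t ↦ ∫ ψ dF t` is continuous
on `[0,∞)` for every continuous `ψ` of growth `|ψ(v)| ≲ ⟨v⟩^α`.
Only the values of `F` at times `t ≥ 0` matter. -/
structure IsContinuousPath (α : ℝ) (F : ℝ → Measure V) : Prop where
  mem : ∀ t : ℝ, 0 ≤ t → MemP α (F t)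
  continuousOn : ∀ ψ : V → ℝ, Continuous ψ →
    (∃ C : ℝ, ∀ v : V, |ψ v| ≤ C * (Real.sqrt (1 + ‖v‖ ^ 2)) ^ α) →
    ContinuousOn (fun t : ℝ => ∫ v, ψ v ∂(F t)) (Ici 0)

/-- The test functions `C²_b(ℝ³)`: `C²` and bounded together with the derivatives of order
at most two. -/
structure IsTestFunction (ψ : V → ℝ) : Prop where
  contDiff : ContDiff ℝ 2 ψ
  bounded : ∀ k : ℕ, k ≤ 2 → ∃ C : ℝ, ∀ v : V, ‖iteratedFDeriv ℝ k ψ v‖ ≤ C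

/-- The post-collisional velocity `v'` for the restitution coefficient `e`. -/
def postV (e : ℝ) (v w σ : V) : V :=
  (1 / 2 : ℝ) • (v + w) + ((1 - e) / 4) • (v - w) + ((1 + e) / 4 * ‖v - w‖) • σ

/-- The post-collisional velocity `v'_*` for the restitution coefficient `e`. -/
def postW (e : ℝ) (v w σ : V) : V :=
  (1 / 2 : ℝ) • (v + w) - ((1 - e) / 4) • (v - w) - ((1 + e) / 4 * ‖v - w‖) • σ

/-- A non-negative angular kernel, a function of `cos θ ∈ [-1,1]`, that satisfies
Grad's cutoff assumption `∫_{𝕊²} b(k · σ) dσ < ∞` for unit vectors `k`. -/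
structure IsCutoffAngularKernel (b : ℝ → ℝ) : Prop where
  measurable : Measurable b
  nonneg : ∀ x ∈ Icc (-1 : ℝ) 1, 0 ≤ b x
  integrable : ∀ k : V, ‖k‖ = 1 →
    Integrable (fun σ : S2 => b (inner ℝ k (σ : V))) surfaceMeasure

/-- A smooth radial cutoff `x ↦ φ(|x|)` on `ℝ³` with values in `[0,1]`, equal to `1` for `|x| ≤ 1`
and to `0` for `|x| > 2`. -/
structure IsCutoffProfile (φ : ℝ → ℝ) : Prop where
  contDiff : ContDiff ℝ ∞ (fun x : V => φ ‖x‖)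
  nonneg : ∀ r : ℝ, 0 ≤ r → 0 ≤ φ r
  le_one : ∀ r : ℝ, 0 ≤ r → φ r ≤ 1
  eq_one : ∀ r : ℝ, 0 ≤ r → r ≤ 1 → φ r = 1
  eq_zero : ∀ r : ℝ, 2 < r → φ r = 0

/-- The truncated kinetic kernel `Φ_n(r) = r^γ φ(r / n)`, for `r = |v - v_*| ≥ 0`. -/
def kineticKernel (γ : ℝ) (φ : ℝ → ℝ) (n : ℕ) (r : ℝ) : ℝ :=
  r ^ γ * φ (r / n)

/-- The collision kernel in product form, `B = b(v̂₋ · σ) Φ(|v - v_*|)` with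
`v̂₋ = (v - v_*) / |v - v_*|`. -/
def collisionKernel (b Φ : ℝ → ℝ) (v w σ : V) : ℝ :=
  b (inner ℝ ((‖v - w‖)⁻¹ • (v - w)) σ) * Φ ‖v - w‖

/-- The weak form of the inelastic collision operator, `⟨Q_e(F, F), ψ⟩ =
½ ∫∫∫ B (ψ(v') + ψ(v'_*) - ψ(v) - ψ(v_*)) dσ dF(v_*) dF(v)`. -/
def weakCollision (e : ℝ) (B : V → V → V → ℝ) (F : Measure V) (ψ : V → ℝ) : ℝ :=
  (1 / 2) * ∫ v, ∫ w, ∫ σ : S2,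
    B v w σ * (ψ (postV e v w σ) + ψ (postW e v w σ) - ψ v - ψ w) ∂surfaceMeasure ∂F ∂F

/-- `F ∈ C([0,∞), P_α)` is a measure-valued solution of `∂ₜ F = Q_e(F, F)` with collision
kernel `B` and initial datum `F₀`. -/
structure IsMeasureSolution (e : ℝ) (B : V → V → V → ℝ) (α : ℝ) (F₀ : Measure V)
    (F : ℝ → Measure V) : Prop where
  path : IsContinuousPath α F
  initial : F 0 = F₀
  weak : ∀ ψ : V → ℝ, IsTestFunction ψ → ∀ t : ℝ, 0 ≤ t →
    ∫ v, ψ v ∂(F t) - ∫ v, ψ v ∂F₀ = ∫ τ in (0 : ℝ)..t, weakCollision e B (F τ) ψ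

/-- The truncation `min {b, n}` of a non-negative (possibly non-integrable) angular kernel `b`
satisfies the cutoff assumption. -/
theorem isCutoffAngularKernel_min {b : ℝ → ℝ} (hb : Measurable b)
    (hb0 : ∀ x ∈ Icc (-1 : ℝ) 1, 0 ≤ b x) (n : ℕ) :
    IsCutoffAngularKernel (fun x => min (b x) n) where
  measurable := hb.min measurable_const
  nonneg x hx := le_min (hb0 x hx) n.cast_nonneg
  integrable k hk := by
    have hfin : IsFiniteMeasure surfaceMeasure := by unfold surfaceMeasure; infer_instance
    have hm : Measurable (fun σ : S2 => min (b (inner ℝ k (σ : V))) (n : ℝ)) :=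
      (hb.comp (by fun_prop)).min measurable_const
    refine Integrable.of_bound hm.aestronglyMeasurable (n : ℝ) (Filter.Eventually.of_forall ?_)
    intro σ
    have hσ : ‖(σ : V)‖ = 1 := by simp
    have h1 : |inner ℝ k (σ : V)| ≤ 1 := by
      simpa [hk, hσ] using abs_real_inner_le_norm k (σ : V)
    have h0 := hb0 _ (abs_le.1 h1)
    rw [Real.norm_eq_abs, abs_of_nonneg (le_min h0 n.cast_nonneg)]
    exact min_le_right _ _

end

end InelasticBoltzmann

/-!
The angular cutoff makes the total collision rate `∫ B(v, w, σ) dσ` bounded: the surface measure is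
rotation invariant, so the angular integral does not depend on the direction of `v - w`, and `Φ_n`
is bounded. Take `M > 0` above this rate and let every pair of particles carry a clock of rate `M`,
at whose ticks it collides with intensity `B dσ` and otherwise nothing happens. This gives a Markov
kernel `κ` from pairs of velocities to velocities (`HasRateBound.kernel`), and with
`gain(F, F) = κ ∘ (F ⊗ F)` the equation becomes `∂ₜ F = M (gain(F, F) - F)`
(`HasRateBound.weakCollision_eq`), a quadratic equation between probability measures.

Existence: the Wild sum `F_t = e^{-Mt} ∑ₖ (1 - e^{-Mt})ᵏ Gₖ` with `G₀ = F₀` and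
`(k + 1) Gₖ₊₁ = ∑_{i + j = k} gain(Gᵢ, Gⱼ)` is a solution. Tested against `ψ`, it is
`(1 - s) ∑ aₖ sᵏ` with `s = 1 - e^{-Mt}` and `aₖ = ∫ ψ dGₖ`, and `gain(F_t, F_t)` corresponds to the
derived series (`gain_wildSum`). Since collisions do not increase energy, `1 + |v|^α` is at most
doubled by a collision for `α ≤ 2`; hence `aₖ = O(k)` for all `ψ` of this growth, and the path is
continuous in `P_α` (`HasRateBound.isMeasureSolution_wildSum`). For the energy, the recursion gives
`(k + 1) aₖ₊₁ ≤ a₀ + ⋯ + aₖ`, which says that the derivative in time is nonpositive; for momentum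
it gives `aₖ = a₀`.

Uniqueness: the functions `cos ⟨·, ξ⟩` and `sin ⟨·, ξ⟩` are admissible, so by injectivity of the
Fourier transform the weak equation is an identity of finite measures (`SolvesIntegrated`), and
may be tested with bounded measurable functions. As `F ↦ gain(F, F)` is Lipschitz in total
variation, iterating the integrated equation bounds the distance of two solutions by
`2 (3Mt)ᵏ / k!` for every `k` (`SolvesIntegrated.abs_integral_sub_le`).
-/

/-! ### Power series with polynomially bounded coefficients -/

namespace InelasticBoltzmann

section PowerSeries

variable {a : ℕ → ℝ} {C : ℝ} {p : ℕ}

theorem summable_norm_mul_pow (ha : ∀ k, |a k| ≤ C * ((k : ℝ) + 1) ^ p) {s : ℝ} (hs : |s| < 1) :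
    Summable fun k => ‖a k * s ^ k‖ := by
  rcases eq_or_ne s 0 with rfl | h0
  · refine summable_of_hasFiniteSupport ((Set.finite_singleton 0).subset fun k hk => ?_)
    by_contra hne
    have : k ≠ 0 := hne
    simp [this] at hk
  have h1 : Summable fun k : ℕ => ((k : ℝ)) ^ p * |s| ^ k :=
    summable_pow_mul_geometric_of_norm_lt_one p (by simpa using hs)
  have h2 := ((summable_nat_add_iff 1).2 h1).mul_left (C * |s|⁻¹)
  refine Summable.of_nonneg_of_le (fun k => norm_nonneg _) (fun k => ?_) h2
  have hpos : 0 < |s| := abs_pos.2 h0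
  rw [norm_mul, norm_pow, Real.norm_eq_abs, Real.norm_eq_abs]
  push_cast
  calc |a k| * |s| ^ k ≤ C * ((k : ℝ) + 1) ^ p * |s| ^ k := by gcongr; exact ha k
    _ = _ := by field_simp; ring

theorem abs_succ_mul_le (ha : ∀ k, |a k| ≤ C * ((k : ℝ) + 1) ^ p) (k : ℕ) :
    |((k : ℝ) + 1) * a (k + 1)| ≤ C * 2 ^ p * ((k : ℝ) + 1) ^ (p + 1) := by
  have hC : 0 ≤ C := by simpa using (abs_nonneg _).trans (ha 0)
  rw [abs_mul, abs_of_nonneg (by positivity)]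
  have h1 : |a (k + 1)| ≤ C * (2 * ((k : ℝ) + 1)) ^ p := by
    refine (ha _).trans ?_
    gcongr
    push_cast
    linarith [(Nat.cast_nonneg k : (0 : ℝ) ≤ k)]
  calc ((k : ℝ) + 1) * |a (k + 1)| ≤ ((k : ℝ) + 1) * (C * (2 * ((k : ℝ) + 1)) ^ p) := by gcongr
    _ = _ := by rw [mul_pow]; ring

theorem hasDerivAt_tsum_mul_pow (ha : ∀ k, |a k| ≤ C * ((k : ℝ) + 1) ^ p) {s : ℝ}
    (hs : |s| < 1) :
    HasDerivAt (fun x => ∑' k, a k * x ^ k) (∑' k : ℕ, ((k : ℝ) + 1) * a (k + 1) * s ^ k) s := by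
  obtain ⟨r, hsr, hr1⟩ := exists_between hs
  have hr0 : 0 < r := (abs_nonneg s).trans_lt hsr
  have hr : |r| < 1 := by rwa [abs_of_pos hr0]
  have hsum := (summable_norm_mul_pow (abs_succ_mul_le ha) hr)
  -- the derived series, with the vanishing term of index `0` put back
  let d : ℕ → ℝ → ℝ := fun k x => a k * (k * x ^ (k - 1))
  have hu : Summable fun k => ‖d k r‖ := by
    refine (summable_nat_add_iff 1).1 (hsum.congr fun k => ?_)
    simp only [d, Nat.add_sub_cancel]
    push_cast
    congr 1
    ring
  have hd : ∀ k : ℕ, ∀ x ∈ Metric.ball (0 : ℝ) r, HasDerivAt (fun x => a k * x ^ k) (d k x) x :=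
    fun k x _ => (hasDerivAt_pow k x).const_mul _
  have hb : ∀ k : ℕ, ∀ x ∈ Metric.ball (0 : ℝ) r, ‖d k x‖ ≤ ‖d k r‖ := by
    intro k x hx
    have hx' : |x| ≤ r := by simpa using (Metric.mem_ball.1 hx).le
    simp only [d, norm_mul, norm_pow, Real.norm_eq_abs, abs_of_pos hr0]
    gcongr
  have key := hasDerivAt_tsum_of_isPreconnected hu Metric.isOpen_ball
    (convex_ball (0 : ℝ) r).isPreconnected hd hb (Metric.mem_ball_self hr0)
    ((summable_norm_mul_pow ha (s := 0) (by simp)).of_norm) (y := s) (by simpa using hsr)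
  refine key.congr_deriv ?_
  have hs' : Summable fun k => d k s :=
    Summable.of_norm_bounded hu fun k => hb k s (by simpa using hsr)
  rw [hs'.tsum_eq_zero_add]
  simp only [d, Nat.add_sub_cancel, Nat.cast_zero, zero_mul, mul_zero, zero_add]
  refine tsum_congr fun k => ?_
  push_cast
  ring

/-- Multiplying a power series by `(1 - s)⁻¹` replaces its coefficients by their partial sums. -/
theorem one_sub_mul_tsum_sum_range (ha : ∀ k, |a k| ≤ C * ((k : ℝ) + 1) ^ p) {s : ℝ}
    (hs : |s| < 1) :
    Summable (fun k => (∑ j ∈ Finset.range (k + 1), a j) * s ^ k) ∧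
    (1 - s) * ∑' k, (∑ j ∈ Finset.range (k + 1), a j) * s ^ k = ∑' k, a k * s ^ k := by
  have h1 := summable_norm_mul_pow ha hs
  have h2 : Summable fun k => ‖s ^ k‖ := by
    simpa using summable_geometric_of_lt_one (abs_nonneg s) hs
  have h3 : ∀ k, (∑ j ∈ Finset.range (k + 1), a j) * s ^ k
      = ∑ j ∈ Finset.range (k + 1), a j * s ^ j * s ^ (k - j) := by
    intro k
    rw [Finset.sum_mul]
    refine Finset.sum_congr rfl fun j hj => ?_
    rw [mul_assoc, ← pow_add, Nat.add_sub_cancel' (Nat.lt_succ_iff.1 (Finset.mem_range.1 hj))]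
  have h4 := tsum_mul_tsum_eq_tsum_sum_range_of_summable_norm h1 h2
  have h5 := (summable_norm_sum_mul_range_of_summable_norm h1 h2).of_norm
  simp_rw [h3]
  refine ⟨h5, ?_⟩
  rw [← h4, tsum_geometric_of_norm_lt_one (by simpa using hs)]
  have : 1 - s ≠ 0 := by linarith [(abs_lt.1 hs).2]
  field_simp

/-- The function `(1 - s) ∑ aₖ sᵏ` along `s = 1 - exp (-M t)`. -/
theorem hasDerivAt_exp_mul_tsum (ha : ∀ k, |a k| ≤ C * ((k : ℝ) + 1) ^ p) (M : ℝ) {t : ℝ}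
    (ht : |1 - Real.exp (-(M * t))| < 1) :
    HasDerivAt
      (fun t => Real.exp (-(M * t)) * ∑' k, a k * (1 - Real.exp (-(M * t))) ^ k)
      (M * (Real.exp (-(M * t)) ^ 2 *
          (∑' k : ℕ, ((k : ℝ) + 1) * a (k + 1) * (1 - Real.exp (-(M * t))) ^ k) -
        Real.exp (-(M * t)) * ∑' k, a k * (1 - Real.exp (-(M * t))) ^ k)) t := by
  have he : HasDerivAt (fun t => Real.exp (-(M * t))) (Real.exp (-(M * t)) * (-M)) t := by
    have : HasDerivAt (fun t => -(M * t)) (-M) t := by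
      simpa using ((hasDerivAt_id t).const_mul M).fun_neg
    exact this.exp
  have hs : HasDerivAt (fun t => 1 - Real.exp (-(M * t))) (M * Real.exp (-(M * t))) t :=
    (he.const_sub 1).congr_deriv (by ring)
  have hf := (hasDerivAt_tsum_mul_pow ha ht).comp t hs
  exact (he.mul hf).congr_deriv (by simp only [Function.comp]; ring)

theorem abs_one_sub_exp_neg_lt_one {M t : ℝ} (hM : 0 ≤ M) (ht : 0 ≤ t) :
    |1 - Real.exp (-(M * t))| < 1 := by
  have h1 : Real.exp (-(M * t)) ≤ 1 := Real.exp_le_one_iff.2 (by nlinarith)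
  have h2 := Real.exp_pos (-(M * t))
  rw [abs_of_nonneg (by linarith)]
  linarith

end PowerSeries

end InelasticBoltzmann

/-! ### Wild sums for a binary collision kernel -/

namespace InelasticBoltzmann

open ProbabilityTheory
open scoped ENNReal

noncomputable section

variable {E : Type*} [MeasurableSpace E]

/-- The gain operator of a binary collision kernel `κ`: the law of a particle emerging from the
collision of two independent particles with laws `μ` and `ν`. -/
def gain (κ : Kernel (E × E) E) (μ ν : Measure E) : Measure E := κ ∘ₘ (μ.prod ν)

/-- The Wild terms `G₀ = μ`, `(k + 1) Gₖ₊₁ = ∑_{i + j = k} gain(Gᵢ, Gⱼ)`: `Gₖ` is the law of a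
particle whose history is a random collision tree with `k` collisions. -/
def wildTerm (κ : Kernel (E × E) E) (μ : Measure E) : ℕ → Measure E
  | 0 => μ
  | k + 1 => ((k : ℝ≥0∞) + 1)⁻¹ •
      ∑ i : Fin (k + 1), gain κ (wildTerm κ μ i) (wildTerm κ μ (k - i))
  termination_by k => k
  decreasing_by all_goals omega

/-- The Wild sum `e^{-Mt} ∑ₖ (1 - e^{-Mt})ᵏ Gₖ`, the solution at time `t` of
`∂ₜ F = M (gain(F, F) - F)`, `F₀ = μ`. -/
def wildSum (κ : Kernel (E × E) E) (M : ℝ) (μ : Measure E) (t : ℝ) : Measure E :=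
  Measure.sum fun k =>
    ENNReal.ofReal (Real.exp (-(M * t)) * (1 - Real.exp (-(M * t))) ^ k) • wildTerm κ μ k

variable {κ : Kernel (E × E) E} {μ ν : Measure E} {M : ℝ}

instance isProbabilityMeasure_gain [IsMarkovKernel κ] [IsProbabilityMeasure μ]
    [IsProbabilityMeasure ν] : IsProbabilityMeasure (gain κ μ ν) := by
  unfold gain; infer_instance

theorem lintegral_gain {f : E → ℝ≥0∞} (hf : Measurable f) :
    ∫⁻ z, f z ∂gain κ μ ν = ∫⁻ q, ∫⁻ z, f z ∂κ q ∂μ.prod ν :=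
  Measure.lintegral_bind κ.aemeasurable hf.aemeasurable

theorem lintegral_gain_le [IsProbabilityMeasure μ] [IsProbabilityMeasure ν] {p : E → ℝ≥0∞}
    (hp : Measurable p) {c : ℝ≥0∞} (h : ∀ q, ∫⁻ z, p z ∂κ q ≤ c * (p q.1 + p q.2)) :
    ∫⁻ z, p z ∂gain κ μ ν ≤ c * (∫⁻ z, p z ∂μ + ∫⁻ z, p z ∂ν) := by
  rw [lintegral_gain hp]
  calc ∫⁻ q, ∫⁻ z, p z ∂κ q ∂μ.prod ν ≤ ∫⁻ q, c * (p q.1 + p q.2) ∂μ.prod ν := lintegral_mono h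
    _ = c * (∫⁻ z, p z ∂μ + ∫⁻ z, p z ∂ν) := by
      rw [lintegral_const_mul _ (by fun_prop), lintegral_add_left (by fun_prop),
        lintegral_prod _ (by fun_prop), lintegral_prod _ (by fun_prop)]
      simp

theorem integral_bind_kernel {X Y : Type*} [MeasurableSpace X] [MeasurableSpace Y]
    {η : Kernel X Y} {ρ : Measure X} {ψ : Y → ℝ} (hi : Integrable ψ (η ∘ₘ ρ)) :
    ∫ z, ψ z ∂(η ∘ₘ ρ) = ∫ x, ∫ z, ψ z ∂η x ∂ρ := by
  rw [Measure.comp_eq_comp_const_apply] at hi ⊢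
  rw [Kernel.integral_comp hi]
  simp

theorem integral_gain {ψ : E → ℝ} (hi : Integrable ψ (gain κ μ ν)) :
    ∫ z, ψ z ∂gain κ μ ν = ∫ q, ∫ z, ψ z ∂κ q ∂μ.prod ν :=
  integral_bind_kernel hi

@[simp] theorem wildTerm_zero : wildTerm κ μ 0 = μ := by rw [wildTerm]

theorem succ_smul_wildTerm (k : ℕ) :
    ((k : ℝ≥0∞) + 1) • wildTerm κ μ (k + 1) =
      ∑ q ∈ Finset.HasAntidiagonal.antidiagonal k, gain κ (wildTerm κ μ q.1) (wildTerm κ μ q.2) := by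
  rw [wildTerm, smul_smul, ENNReal.mul_inv_cancel (by simp) (by simp), one_smul,
    Finset.Nat.sum_antidiagonal_eq_sum_range_succ_mk,
    Fin.sum_univ_eq_sum_range (fun i => gain κ (wildTerm κ μ i) (wildTerm κ μ (k - i)))]

instance isProbabilityMeasure_wildTerm [IsMarkovKernel κ] [IsProbabilityMeasure μ] (k : ℕ) :
    IsProbabilityMeasure (wildTerm κ μ k) := by
  induction k using Nat.strong_induction_on with
  | _ k ih =>
    rcases k with _ | k
    · simpa
    · have h := congrArg (fun ρ : Measure E => ρ univ) (succ_smul_wildTerm (κ := κ) (μ := μ) k)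
      simp only [Measure.smul_apply, Measure.coe_finsetSum, Finset.sum_apply] at h
      rw [Finset.sum_congr rfl (g := fun _ => 1)] at h
      · refine ⟨?_⟩
        have h2 : ((k : ℝ≥0∞) + 1) * wildTerm κ μ (k + 1) univ = ((k : ℝ≥0∞) + 1) * 1 := by
          simpa using h
        exact (ENNReal.mul_right_inj (by simp) (by simp)).1 h2
      · intro q hq
        have h1 : q.1 + q.2 = k := Finset.HasAntidiagonal.mem_antidiagonal.1 hq
        have := ih q.1 (by omega)
        have := ih q.2 (by omega)
        exact measure_univ

/-! ### Moments of the Wild terms -/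

section Moments

variable [IsMarkovKernel κ] [IsProbabilityMeasure μ] {p : E → ℝ≥0∞}

theorem succ_mul_lintegral_wildTerm_le (hp : Measurable p) {c : ℝ≥0∞}
    (h : ∀ q, ∫⁻ z, p z ∂κ q ≤ c * (p q.1 + p q.2)) (k : ℕ) :
    ((k : ℝ≥0∞) + 1) * ∫⁻ z, p z ∂wildTerm κ μ (k + 1) ≤
      2 * c * ∑ j ∈ Finset.range (k + 1), ∫⁻ z, p z ∂wildTerm κ μ j := by
  have h1 : ((k : ℝ≥0∞) + 1) * ∫⁻ z, p z ∂wildTerm κ μ (k + 1) =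
      ∑ q ∈ Finset.HasAntidiagonal.antidiagonal k,
        ∫⁻ z, p z ∂gain κ (wildTerm κ μ q.1) (wildTerm κ μ q.2) := by
    rw [← lintegral_finsetSum_measure, ← succ_smul_wildTerm, lintegral_smul_measure, smul_eq_mul]
  rw [h1]
  refine (Finset.sum_le_sum fun q _ => lintegral_gain_le hp h).trans ?_
  rw [← Finset.mul_sum, Finset.sum_add_distrib]
  have h2 : ∑ q ∈ Finset.HasAntidiagonal.antidiagonal k, ∫⁻ z, p z ∂wildTerm κ μ q.1 =
      ∑ j ∈ Finset.range (k + 1), ∫⁻ z, p z ∂wildTerm κ μ j :=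
    Finset.Nat.sum_antidiagonal_eq_sum_range_succ (fun i _ => ∫⁻ z, p z ∂wildTerm κ μ i) k
  have h3 : ∑ q ∈ Finset.HasAntidiagonal.antidiagonal k, ∫⁻ z, p z ∂wildTerm κ μ q.2 =
      ∑ j ∈ Finset.range (k + 1), ∫⁻ z, p z ∂wildTerm κ μ j := by
    rw [← h2]
    exact Finset.Nat.sum_antidiagonal_swap (f := fun q : ℕ × ℕ => ∫⁻ z, p z ∂wildTerm κ μ q.1)
  rw [h2, h3, ← two_mul, ← mul_assoc, mul_comm c]

/-- A moment that a collision at most adds up grows at most linearly along the Wild terms. -/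
theorem lintegral_wildTerm_le (hp : Measurable p)
    (h : ∀ q, ∫⁻ z, p z ∂κ q ≤ p q.1 + p q.2) (k : ℕ) :
    ∫⁻ z, p z ∂wildTerm κ μ k ≤ ((k : ℝ≥0∞) + 1) * ∫⁻ z, p z ∂μ := by
  induction k using Nat.strong_induction_on with
  | _ k ih =>
    rcases k with _ | k
    · simp
    · have h1 := succ_mul_lintegral_wildTerm_le (κ := κ) (μ := μ) hp (c := 1) (by simpa using h) k
      have h2 : ∀ m : ℕ, 2 * ∑ j ∈ Finset.range (m + 1), (((j : ℝ≥0∞) + 1) * ∫⁻ z, p z ∂μ) =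
          ((m : ℝ≥0∞) + 1) * (((m : ℝ≥0∞) + 2) * ∫⁻ z, p z ∂μ) := by
        intro m
        induction m with
        | zero => simp
        | succ m ihm =>
          rw [Finset.sum_range_succ, mul_add, ihm]
          push_cast
          ring
      have h3 := Finset.sum_le_sum fun j (hj : j ∈ Finset.range (k + 1)) =>
        ih j (Finset.mem_range.1 hj)
      rw [mul_one] at h1
      have h4 := h1.trans ((mul_le_mul_right h3 2).trans (h2 k).le)
      have h5 := (ENNReal.mul_le_mul_iff_right (by simp) (by simp)).1 h4
      push_cast
      rw [add_assoc, one_add_one_eq_two]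
      exact h5

end Moments

end

end InelasticBoltzmann

namespace InelasticBoltzmann

open ProbabilityTheory
open scoped ENNReal

noncomputable section

variable {E : Type*} [MeasurableSpace E] {κ : Kernel (E × E) E} {μ : Measure E} {M t : ℝ}

/-! ### Integrals against Wild sums -/

/-- A weight `p` with finite integral against `μ` that collisions at most add up. Test functions
dominated by such a weight can be integrated against all Wild terms and Wild sums. -/
structure IsMomentWeight (κ : Kernel (E × E) E) (μ : Measure E) (p : E → ℝ≥0∞) : Prop where
  measurable : Measurable p
  lintegral_le : ∀ q, ∫⁻ z, p z ∂κ q ≤ p q.1 + p q.2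
  ne_top : ∫⁻ z, p z ∂μ ≠ ⊤

theorem isMomentWeight_const [IsMarkovKernel κ] [IsProbabilityMeasure μ] {c : ℝ≥0∞}
    (hc : c ≠ ⊤) : IsMomentWeight κ μ fun _ => c where
  measurable := measurable_const
  lintegral_le q := by simp
  ne_top := by simpa using hc

theorem integrable_of_enorm_le_weight {p : E → ℝ≥0∞} {ψ : E → ℝ} (hψ : Measurable ψ)
    (hψp : ∀ x, ‖ψ x‖ₑ ≤ p x) {ρ : Measure E} (hρ : ∫⁻ z, p z ∂ρ ≠ ⊤) : Integrable ψ ρ :=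
  ⟨hψ.aestronglyMeasurable, (lintegral_mono hψp).trans_lt hρ.lt_top⟩

theorem ofReal_natCast_add_one (k : ℕ) : ENNReal.ofReal ((k : ℝ) + 1) = (k : ℝ≥0∞) + 1 := by
  rw [ENNReal.ofReal_add (by positivity) (by positivity)]
  simp

theorem wildSum_zero : wildSum κ M μ 0 = μ := by
  refine Measure.ext fun A hA => ?_
  rw [wildSum, Measure.sum_apply _ hA, tsum_eq_single 0]
  · simp
  · intro k hk
    simp [hk]

theorem one_sub_exp_neg_nonneg (hM : 0 ≤ M) (ht : 0 ≤ t) : 0 ≤ 1 - Real.exp (-(M * t)) := by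
  have : Real.exp (-(M * t)) ≤ 1 := Real.exp_le_one_iff.2 (by nlinarith)
  linarith

theorem one_sub_exp_neg_lt_one : 1 - Real.exp (-(M * t)) < 1 := by
  linarith [Real.exp_pos (-(M * t))]

section

variable [IsMarkovKernel κ] [IsProbabilityMeasure μ]

theorem isProbabilityMeasure_wildSum (hM : 0 ≤ M) (ht : 0 ≤ t) :
    IsProbabilityMeasure (wildSum κ M μ t) := by
  have hs := one_sub_exp_neg_nonneg hM ht
  refine ⟨?_⟩
  rw [wildSum, Measure.sum_apply _ .univ]
  simp only [Measure.smul_apply, measure_univ, smul_eq_mul, mul_one]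
  rw [← ENNReal.ofReal_tsum_of_nonneg (fun k => by positivity)
    ((summable_geometric_of_lt_one hs one_sub_exp_neg_lt_one).mul_left _), tsum_mul_left,
    tsum_geometric_of_lt_one hs one_sub_exp_neg_lt_one]
  simp [Real.exp_ne_zero]

/-- The collision identity behind the Wild sum: the gain term of a Wild sum is the derived
series. -/
theorem gain_wildSum (hM : 0 ≤ M) (ht : 0 ≤ t) :
    gain κ (wildSum κ M μ t) (wildSum κ M μ t) = Measure.sum fun k : ℕ =>
      ENNReal.ofReal (Real.exp (-(M * t)) ^ 2 * (1 - Real.exp (-(M * t))) ^ k * ((k : ℝ) + 1)) •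
        wildTerm κ μ (k + 1) := by
  have hs := one_sub_exp_neg_nonneg hM ht
  set r := Real.exp (-(M * t)) with hr
  set s := 1 - r
  have hr0 : 0 ≤ r := (Real.exp_pos _).le
  have h1 : gain κ (wildSum κ M μ t) (wildSum κ M μ t) = Measure.sum fun q : ℕ × ℕ =>
      (ENNReal.ofReal (r * s ^ q.1) * ENNReal.ofReal (r * s ^ q.2)) •
        gain κ (wildTerm κ μ q.1) (wildTerm κ μ q.2) := by
    simp only [gain, wildSum, Measure.prod_sum]
    rw [Measure.bind_sum _ _ κ.aemeasurable]
    congr 1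
    funext q
    rw [Measure.prod_smul_left, Measure.prod_smul_right, smul_smul, Measure.bind_smul]
  refine Measure.ext fun A hA => ?_
  rw [h1, Measure.sum_apply _ hA, Measure.sum_apply _ hA,
    ← Finset.HasAntidiagonal.sigmaAntidiagonalEquivProd.tsum_eq, ENNReal.tsum_sigma']
  refine tsum_congr fun k => ?_
  have h2 : ∀ q ∈ Finset.HasAntidiagonal.antidiagonal k,
      ((ENNReal.ofReal (r * s ^ q.1) * ENNReal.ofReal (r * s ^ q.2)) •
        gain κ (wildTerm κ μ q.1) (wildTerm κ μ q.2)) A =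
      ENNReal.ofReal (r ^ 2 * s ^ k) * gain κ (wildTerm κ μ q.1) (wildTerm κ μ q.2) A := by
    intro q hq
    rw [Measure.smul_apply, smul_eq_mul, ← ENNReal.ofReal_mul (by positivity),
      ← Finset.HasAntidiagonal.mem_antidiagonal.1 hq]
    congr 2
    ring
  rw [tsum_fintype]
  simp only [Finset.HasAntidiagonal.sigmaAntidiagonalEquivProd_apply]
  rw [Finset.sum_coe_sort (Finset.HasAntidiagonal.antidiagonal k) (fun q =>
    ((ENNReal.ofReal (r * s ^ q.1) * ENNReal.ofReal (r * s ^ q.2)) •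
        gain κ (wildTerm κ μ q.1) (wildTerm κ μ q.2)) A), Finset.sum_congr rfl h2,
    ← Finset.mul_sum]
  have h3 := congrArg (fun ρ : Measure E => ρ A) (succ_smul_wildTerm (κ := κ) (μ := μ) k)
  simp only [Measure.smul_apply, Measure.coe_finsetSum, Finset.sum_apply, smul_eq_mul] at h3
  rw [← h3, Measure.smul_apply, smul_eq_mul, ← mul_assoc,
    ENNReal.ofReal_mul (p := r ^ 2 * s ^ k) (by positivity), ofReal_natCast_add_one]

namespace IsMomentWeight

variable {p : E → ℝ≥0∞} (hp : IsMomentWeight κ μ p)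
include hp

theorem lintegral_wildTerm_ne_top (k : ℕ) : ∫⁻ z, p z ∂wildTerm κ μ k ≠ ⊤ :=
  ne_top_of_le_ne_top (ENNReal.mul_ne_top (by simp) hp.ne_top)
    (lintegral_wildTerm_le hp.measurable hp.lintegral_le k)

theorem lintegral_wildSum_ne_top (hM : 0 ≤ M) (ht : 0 ≤ t) :
    ∫⁻ z, p z ∂wildSum κ M μ t ≠ ⊤ := by
  have hs := one_sub_exp_neg_nonneg hM ht
  have hs1 := abs_one_sub_exp_neg_lt_one hM ht
  rw [wildSum, lintegral_sum_measure]
  have h1 : Summable fun k : ℕ => Real.exp (-(M * t)) *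
      (((∫⁻ z, p z ∂μ).toReal * ((k : ℝ) + 1)) * (1 - Real.exp (-(M * t))) ^ k) := by
    refine (summable_norm_mul_pow (C := (∫⁻ z, p z ∂μ).toReal) (p := 1) (fun k => ?_)
      hs1).of_norm.mul_left _
    rw [abs_of_nonneg (by positivity), pow_one]
  refine ne_top_of_le_ne_top h1.tsum_ofReal_ne_top (ENNReal.tsum_le_tsum fun k => ?_)
  rw [lintegral_smul_measure, smul_eq_mul]
  calc _ ≤ ENNReal.ofReal (Real.exp (-(M * t)) * (1 - Real.exp (-(M * t))) ^ k) *
        (((k : ℝ≥0∞) + 1) * ∫⁻ z, p z ∂μ) := by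
        gcongr
        exact lintegral_wildTerm_le hp.measurable hp.lintegral_le k
    _ = ENNReal.ofReal (Real.exp (-(M * t)) * (1 - Real.exp (-(M * t))) ^ k) *
        ENNReal.ofReal (((k : ℝ) + 1) * (∫⁻ z, p z ∂μ).toReal) := by
        rw [ENNReal.ofReal_mul (p := (k : ℝ) + 1) (by positivity),
          ENNReal.ofReal_toReal hp.ne_top, ofReal_natCast_add_one]
    _ = _ := by
        rw [← ENNReal.ofReal_mul (by positivity)]
        congr 1
        ring

omit [IsMarkovKernel κ] [IsProbabilityMeasure μ] in
theorem lintegral_gain_ne_top {ρ : Measure E} [IsProbabilityMeasure ρ]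
    (hρ : ∫⁻ z, p z ∂ρ ≠ ⊤) : ∫⁻ z, p z ∂gain κ ρ ρ ≠ ⊤ := by
  refine ne_top_of_le_ne_top ?_
    (lintegral_gain_le hp.measurable (c := 1) (by simpa using hp.lintegral_le))
  simp [hρ]

variable {ψ : E → ℝ} (hψ : Measurable ψ) (hψp : ∀ x, ‖ψ x‖ₑ ≤ p x)
include hψ hψp

theorem integrable_wildTerm (k : ℕ) : Integrable ψ (wildTerm κ μ k) :=
  integrable_of_enorm_le_weight hψ hψp (hp.lintegral_wildTerm_ne_top k)

theorem integrable_wildSum (hM : 0 ≤ M) (ht : 0 ≤ t) : Integrable ψ (wildSum κ M μ t) :=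
  integrable_of_enorm_le_weight hψ hψp (hp.lintegral_wildSum_ne_top hM ht)

theorem integrable_gain_wildSum (hM : 0 ≤ M) (ht : 0 ≤ t) :
    Integrable ψ (gain κ (wildSum κ M μ t) (wildSum κ M μ t)) :=
  have := isProbabilityMeasure_wildSum (κ := κ) (μ := μ) hM ht
  integrable_of_enorm_le_weight hψ hψp
    (hp.lintegral_gain_ne_top (hp.lintegral_wildSum_ne_top hM ht))

omit hψ in
theorem abs_integral_wildTerm_le (k : ℕ) :
    |∫ z, ψ z ∂wildTerm κ μ k| ≤ (∫⁻ z, p z ∂μ).toReal * ((k : ℝ) + 1) ^ 1 := by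
  have h1 : ‖∫ z, ψ z ∂wildTerm κ μ k‖ₑ ≤ ((k : ℝ≥0∞) + 1) * ∫⁻ z, p z ∂μ :=
    (enorm_integral_le_lintegral_enorm _).trans ((lintegral_mono hψp).trans
      (lintegral_wildTerm_le hp.measurable hp.lintegral_le k))
  have h2 := ENNReal.toReal_mono (ENNReal.mul_ne_top (by simp) hp.ne_top) h1
  rw [ENNReal.toReal_mul, toReal_enorm, Real.norm_eq_abs] at h2
  rw [pow_one, mul_comm]
  refine h2.trans (le_of_eq ?_)
  rw [← ofReal_natCast_add_one, ENNReal.toReal_ofReal (by positivity)]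

theorem integral_wildSum (hM : 0 ≤ M) (ht : 0 ≤ t) :
    ∫ z, ψ z ∂wildSum κ M μ t = Real.exp (-(M * t)) *
      ∑' k, (∫ z, ψ z ∂wildTerm κ μ k) * (1 - Real.exp (-(M * t))) ^ k := by
  have hs := one_sub_exp_neg_nonneg hM ht
  have hi := hp.integrable_wildSum hψ hψp hM ht
  rw [wildSum] at hi ⊢
  rw [integral_sum_measure hi, ← tsum_mul_left]
  refine tsum_congr fun k => ?_
  rw [integral_smul_measure, ENNReal.toReal_ofReal (by positivity), smul_eq_mul]
  ring

theorem integral_gain_wildSum (hM : 0 ≤ M) (ht : 0 ≤ t) :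
    ∫ z, ψ z ∂gain κ (wildSum κ M μ t) (wildSum κ M μ t) = Real.exp (-(M * t)) ^ 2 *
      ∑' k : ℕ, ((k : ℝ) + 1) * (∫ z, ψ z ∂wildTerm κ μ (k + 1)) *
        (1 - Real.exp (-(M * t))) ^ k := by
  have hs := one_sub_exp_neg_nonneg hM ht
  have hi := hp.integrable_gain_wildSum hψ hψp hM ht
  rw [gain_wildSum hM ht] at hi ⊢
  rw [integral_sum_measure hi, ← tsum_mul_left]
  refine tsum_congr fun k => ?_
  rw [integral_smul_measure, ENNReal.toReal_ofReal (by positivity), smul_eq_mul]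
  ring

/-- The equation for Wild sums in differential form. The power series replaces `∫ ψ d(wildSum t)`,
with which it agrees for `t ≥ 0` only, so that the derivative at `t = 0` is two-sided. -/
theorem hasDerivAt_series (hM : 0 ≤ M) (ht : 0 ≤ t) :
    HasDerivAt (fun t => Real.exp (-(M * t)) *
        ∑' k, (∫ z, ψ z ∂wildTerm κ μ k) * (1 - Real.exp (-(M * t))) ^ k)
      (M * (∫ z, ψ z ∂gain κ (wildSum κ M μ t) (wildSum κ M μ t) -
        ∫ z, ψ z ∂wildSum κ M μ t)) t := by
  rw [hp.integral_wildSum hψ hψp hM ht, hp.integral_gain_wildSum hψ hψp hM ht]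
  exact hasDerivAt_exp_mul_tsum (hp.abs_integral_wildTerm_le hψp) M
    (abs_one_sub_exp_neg_lt_one hM ht)

theorem continuousOn_integral_wildSum (hM : 0 ≤ M) :
    ContinuousOn (fun t => ∫ z, ψ z ∂wildSum κ M μ t) (Ici 0) := by
  have h : ContinuousOn (fun t => Real.exp (-(M * t)) *
      ∑' k, (∫ z, ψ z ∂wildTerm κ μ k) * (1 - Real.exp (-(M * t))) ^ k) (Ici 0) :=
    fun t ht => (hp.hasDerivAt_series hψ hψp hM ht).continuousAt.continuousWithinAt
  exact h.congr fun t ht => hp.integral_wildSum hψ hψp hM ht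

theorem continuousOn_integral_gain_wildSum (hM : 0 ≤ M) :
    ContinuousOn (fun t => ∫ z, ψ z ∂gain κ (wildSum κ M μ t) (wildSum κ M μ t)) (Ici 0) := by
  have h : ContinuousOn (fun t => Real.exp (-(M * t)) *
      (Real.exp (-(M * t)) * ∑' k : ℕ, (((k : ℝ) + 1) * ∫ z, ψ z ∂wildTerm κ μ (k + 1)) *
        (1 - Real.exp (-(M * t))) ^ k)) (Ici 0) := by
    refine ContinuousOn.mul (by fun_prop) fun t ht => ?_
    exact (hasDerivAt_exp_mul_tsum (abs_succ_mul_le (hp.abs_integral_wildTerm_le hψp)) M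
      (abs_one_sub_exp_neg_lt_one hM ht)).continuousAt.continuousWithinAt
  refine h.congr fun t ht => ?_
  simp only [hp.integral_gain_wildSum hψ hψp hM ht]
  ring

/-- Wild sums solve `∂ₜ F = M (gain(F, F) - F)` in integrated form. -/
theorem integral_wildSum_sub (hM : 0 ≤ M) (ht : 0 ≤ t) :
    ∫ z, ψ z ∂wildSum κ M μ t - ∫ z, ψ z ∂μ =
      ∫ τ in (0 : ℝ)..t, M * (∫ z, ψ z ∂gain κ (wildSum κ M μ τ) (wildSum κ M μ τ) -
        ∫ z, ψ z ∂wildSum κ M μ τ) := by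
  have h0 : ∀ τ ∈ uIcc 0 t, 0 ≤ τ := fun τ hτ => by
    rw [uIcc_of_le ht] at hτ
    exact hτ.1
  rw [intervalIntegral.integral_eq_sub_of_hasDerivAt
    (fun τ hτ => hp.hasDerivAt_series hψ hψp hM (h0 τ hτ)),
    ← hp.integral_wildSum hψ hψp hM ht, ← hp.integral_wildSum hψ hψp hM le_rfl, wildSum_zero]
  refine ContinuousOn.intervalIntegrable ?_
  exact (continuousOn_const.mul ((hp.continuousOn_integral_gain_wildSum hψ hψp hM).sub
    (hp.continuousOn_integral_wildSum hψ hψp hM))).mono h0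

/-- A quantity that collisions conserve on average is conserved by Wild sums. -/
theorem integral_wildSum_eq (hM : 0 ≤ M) (ht : 0 ≤ t)
    (hc : ∀ q, ∫ z, ψ z ∂κ q = 2⁻¹ * (ψ q.1 + ψ q.2)) :
    ∫ z, ψ z ∂wildSum κ M μ t = ∫ z, ψ z ∂μ := by
  have hk : ∀ k, ∫ z, ψ z ∂wildTerm κ μ k = ∫ z, ψ z ∂μ := by
    intro k
    induction k using Nat.strong_induction_on with
    | _ k ih =>
      rcases k with _ | k
      · simp
      have hgi : ∀ i j, Integrable ψ (gain κ (wildTerm κ μ i) (wildTerm κ μ j)) := fun i j =>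
        integrable_of_enorm_le_weight hψ hψp (ne_top_of_le_ne_top
          (by simp [hp.lintegral_wildTerm_ne_top])
          (lintegral_gain_le hp.measurable (c := 1) (by simpa using hp.lintegral_le)))
      have h1 := congrArg (fun ρ : Measure E => ∫ z, ψ z ∂ρ)
        (succ_smul_wildTerm (κ := κ) (μ := μ) k)
      simp only [integral_smul_measure] at h1
      rw [integral_finsetSum_measure fun q _ => hgi q.1 q.2,
        Finset.sum_congr rfl (g := fun _ => ∫ z, ψ z ∂μ)] at h1
      · have h2 : ((k : ℝ≥0∞) + 1).toReal = (k : ℝ) + 1 := by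
          rw [← ofReal_natCast_add_one, ENNReal.toReal_ofReal (by positivity)]
        simp only [h2, smul_eq_mul, Finset.sum_const, Finset.Nat.card_antidiagonal,
          nsmul_eq_mul] at h1
        push_cast at h1
        exact mul_left_cancel₀ (by positivity) h1
      · intro q hq
        have hq' : q.1 + q.2 = k := Finset.HasAntidiagonal.mem_antidiagonal.1 hq
        have i1 := hp.integrable_wildTerm hψ hψp q.1
        have i2 := hp.integrable_wildTerm hψ hψp q.2
        rw [integral_gain (hgi _ _)]
        simp only [hc]
        rw [integral_const_mul, integral_add (i1.comp_fst _) (i2.comp_snd _),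
          integral_fun_fst, integral_fun_snd, ih q.1 (by omega), ih q.2 (by omega)]
        simp
        ring
  rw [hp.integral_wildSum hψ hψp hM ht]
  simp only [hk]
  rw [tsum_mul_left, tsum_geometric_of_lt_one (one_sub_exp_neg_nonneg hM ht)
    one_sub_exp_neg_lt_one]
  have := Real.exp_ne_zero (-(M * t))
  field_simp
  ring

/-- A quantity that collisions dissipate on average is non-increasing along Wild sums: in terms of
the power series in `s = 1 - e^{-Mt}`, its derivative has coefficients
`(k + 1) aₖ₊₁ - (a₀ + ⋯ + aₖ) ≤ 0`. -/
theorem antitoneOn_integral_wildSum (hM : 0 ≤ M) (hψ0 : ∀ x, 0 ≤ ψ x)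
    (hd : ∀ q, ∫⁻ z, ENNReal.ofReal (ψ z) ∂κ q ≤
      2⁻¹ * (ENNReal.ofReal (ψ q.1) + ENNReal.ofReal (ψ q.2))) :
    AntitoneOn (fun t => ∫ z, ψ z ∂wildSum κ M μ t) (Ici 0) := by
  have hcoef : ∀ k : ℕ, ((k : ℝ) + 1) * ∫ z, ψ z ∂wildTerm κ μ (k + 1) ≤
      ∑ j ∈ Finset.range (k + 1), ∫ z, ψ z ∂wildTerm κ μ j := by
    intro k
    have h1 := succ_mul_lintegral_wildTerm_le (κ := κ) (μ := μ) (by fun_prop) hd k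
    rw [ENNReal.mul_inv_cancel (by simp) (by simp), one_mul] at h1
    simp only [← ofReal_integral_eq_lintegral_ofReal (hp.integrable_wildTerm hψ hψp _)
      (Filter.Eventually.of_forall hψ0)] at h1
    rw [← ENNReal.ofReal_sum_of_nonneg fun j _ => integral_nonneg hψ0] at h1
    rw [← ofReal_natCast_add_one, ← ENNReal.ofReal_mul (by positivity)] at h1
    exact (ENNReal.ofReal_le_ofReal_iff
      (Finset.sum_nonneg fun j _ => integral_nonneg hψ0)).1 h1
  refine antitoneOn_of_hasDerivWithinAt_nonpos (convex_Ici 0)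
    (hp.continuousOn_integral_wildSum hψ hψp hM)
    (f' := fun t => M * (∫ z, ψ z ∂gain κ (wildSum κ M μ t) (wildSum κ M μ t) -
        ∫ z, ψ z ∂wildSum κ M μ t)) (fun t ht => ?_) (fun t ht => ?_)
  · rw [interior_Ici] at ht ⊢
    exact (hp.hasDerivAt_series hψ hψp hM (le_of_lt ht)).hasDerivWithinAt.congr
      (fun t' ht' => hp.integral_wildSum hψ hψp hM (le_of_lt ht'))
      (hp.integral_wildSum hψ hψp hM (le_of_lt ht))
  · rw [interior_Ici] at ht
    have ht' : 0 ≤ t := le_of_lt ht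
    have hs := one_sub_exp_neg_nonneg hM ht'
    have hb := hp.abs_integral_wildTerm_le hψp
    have hs1 := abs_one_sub_exp_neg_lt_one hM ht'
    obtain ⟨hsum, heq⟩ := one_sub_mul_tsum_sum_range hb hs1
    rw [sub_sub_cancel] at heq
    refine mul_nonpos_of_nonneg_of_nonpos hM (sub_nonpos.2 ?_)
    rw [hp.integral_wildSum hψ hψp hM ht', hp.integral_gain_wildSum hψ hψp hM ht', ← heq,
      ← mul_assoc, ← sq]
    refine mul_le_mul_of_nonneg_left (Summable.tsum_le_tsum (fun k => ?_)
      (summable_norm_mul_pow (abs_succ_mul_le hb) hs1).of_norm hsum) (by positivity)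
    exact mul_le_mul_of_nonneg_right (hcoef k) (by positivity)

end IsMomentWeight

end

end

end InelasticBoltzmann

namespace InelasticBoltzmann

open ProbabilityTheory
open scoped ENNReal

noncomputable section

/-! ### Uniqueness for the integrated equation -/

section Uniqueness

variable {E : Type*} [MeasurableSpace E]

theorem integrable_of_abs_le_one {X : Type*} [MeasurableSpace X] {ρ : Measure X}
    [IsFiniteMeasure ρ] {g : X → ℝ} (hg : Measurable g) (hg1 : ∀ x, |g x| ≤ 1) :
    Integrable g ρ :=
  Integrable.of_bound hg.aestronglyMeasurable 1 (Filter.Eventually.of_forall hg1)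

theorem abs_integral_le_one {X : Type*} [MeasurableSpace X] {ρ : Measure X}
    [IsProbabilityMeasure ρ] {g : X → ℝ} (hg1 : ∀ x, |g x| ≤ 1) : |∫ x, g x ∂ρ| ≤ 1 := by
  have := norm_integral_le_of_norm_le_const (μ := ρ) (f := g) (C := 1)
    (Filter.Eventually.of_forall hg1)
  simpa using this

/-- The integrated form of `∂ₜ K = M (gain(K, K) - K)`, as an identity of positive measures. -/
def SolvesIntegrated (κ : Kernel (E × E) E) (M : ℝ) (μ : Measure E) (K : Kernel ℝ E) : Prop :=
  ∀ t, 0 ≤ t → K t + ENNReal.ofReal M • (K ∘ₘ volume.restrict (Ioc 0 t)) =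
    μ + ENNReal.ofReal M • ((κ ∘ₖ (K ×ₖ K)) ∘ₘ volume.restrict (Ioc 0 t))

variable {κ : Kernel (E × E) E} {μ : Measure E} {M t : ℝ} {K L : Kernel ℝ E}

theorem comp_prod_apply [IsMarkovKernel K] (τ : ℝ) :
    (κ ∘ₖ (K ×ₖ K)) τ = gain κ (K τ) (K τ) := by
  rw [Kernel.comp_apply, Kernel.prod_apply, gain]

theorem integral_add_smul_bind (hM : 0 ≤ M) (ht : 0 ≤ t) (ρ : Measure E) [IsFiniteMeasure ρ]
    [IsMarkovKernel K] {g : E → ℝ} (hg : Measurable g) (hg1 : ∀ x, |g x| ≤ 1) :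
    ∫ x, g x ∂(ρ + ENNReal.ofReal M • (K ∘ₘ volume.restrict (Ioc 0 t))) =
      ∫ x, g x ∂ρ + M * ∫ τ in (0 : ℝ)..t, ∫ x, g x ∂K τ := by
  rw [integral_add_measure (integrable_of_abs_le_one hg hg1)
    ((integrable_of_abs_le_one hg hg1).smul_measure ENNReal.ofReal_ne_top),
    integral_smul_measure, ENNReal.toReal_ofReal hM, smul_eq_mul,
    integral_bind_kernel (integrable_of_abs_le_one hg hg1),
    intervalIntegral.integral_of_le ht]

theorem intervalIntegrable_integral_kernel [IsMarkovKernel K] {g : E → ℝ} (hg : Measurable g)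
    (hg1 : ∀ x, |g x| ≤ 1) (a b : ℝ) :
    IntervalIntegrable (fun τ => ∫ x, g x ∂K τ) volume a b := by
  have hm : Measurable fun τ => ∫ x, g x ∂K τ :=
    (hg.stronglyMeasurable.integral_kernel).measurable
  rw [intervalIntegrable_iff, uIoc]
  exact integrable_of_abs_le_one hm fun τ => abs_integral_le_one hg1

theorem SolvesIntegrated.integral_eq [IsMarkovKernel κ] [IsFiniteMeasure μ] [IsMarkovKernel K]
    (hK : SolvesIntegrated κ M μ K) (hM : 0 ≤ M) (ht : 0 ≤ t) {g : E → ℝ} (hg : Measurable g)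
    (hg1 : ∀ x, |g x| ≤ 1) :
    ∫ x, g x ∂K t = ∫ x, g x ∂μ + M * ∫ τ in (0 : ℝ)..t,
      (∫ x, g x ∂gain κ (K τ) (K τ) - ∫ x, g x ∂K τ) := by
  have h := congrArg (fun ρ => ∫ x, g x ∂ρ) (hK t ht)
  simp only [integral_add_smul_bind hM ht _ hg hg1] at h
  simp only [← comp_prod_apply (κ := κ) (K := K)]
  rw [intervalIntegral.integral_sub (intervalIntegrable_integral_kernel hg hg1 0 t)
    (intervalIntegrable_integral_kernel hg hg1 0 t)]
  linarith

/-- `μ ↦ μ ⊗ μ` is Lipschitz with constant `2` for the total variation distance between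
probability measures. -/
theorem abs_integral_prod_sub_le {ρ₁ ρ₂ : Measure E} [IsProbabilityMeasure ρ₁]
    [IsProbabilityMeasure ρ₂] {δ : ℝ}
    (hδ : ∀ g : E → ℝ, Measurable g → (∀ x, |g x| ≤ 1) →
      |∫ x, g x ∂ρ₁ - ∫ x, g x ∂ρ₂| ≤ δ)
    {h : E × E → ℝ} (hh : Measurable h) (hh1 : ∀ q, |h q| ≤ 1) :
    |∫ q, h q ∂ρ₁.prod ρ₁ - ∫ q, h q ∂ρ₂.prod ρ₂| ≤ 2 * δ := by
  have h1 := hδ (fun x => ∫ y, h (x, y) ∂ρ₁)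
    hh.stronglyMeasurable.integral_prod_right'.measurable
    fun x => abs_integral_le_one fun y => hh1 _
  have h2 := hδ (fun y => ∫ x, h (x, y) ∂ρ₂)
    hh.stronglyMeasurable.integral_prod_left'.measurable
    fun y => abs_integral_le_one fun x => hh1 _
  have e1 : ∫ q, h q ∂ρ₁.prod ρ₁ = ∫ x, ∫ y, h (x, y) ∂ρ₁ ∂ρ₁ :=
    integral_prod _ (integrable_of_abs_le_one hh hh1)
  have e2 : ∫ q, h q ∂ρ₂.prod ρ₂ = ∫ y, ∫ x, h (x, y) ∂ρ₂ ∂ρ₂ :=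
    integral_prod_symm _ (integrable_of_abs_le_one hh hh1)
  have e3 : ∫ x, ∫ y, h (x, y) ∂ρ₁ ∂ρ₂ = ∫ y, ∫ x, h (x, y) ∂ρ₂ ∂ρ₁ :=
    integral_integral_swap (f := fun x y => h (x, y)) (integrable_of_abs_le_one hh hh1)
  rw [e1, e2]
  rw [abs_le] at h1 h2 ⊢
  constructor <;> linarith

theorem abs_integral_gain_sub_le [IsMarkovKernel κ] {ρ₁ ρ₂ : Measure E} [IsProbabilityMeasure ρ₁]
    [IsProbabilityMeasure ρ₂] {δ : ℝ}
    (hδ : ∀ g : E → ℝ, Measurable g → (∀ x, |g x| ≤ 1) →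
      |∫ x, g x ∂ρ₁ - ∫ x, g x ∂ρ₂| ≤ δ)
    {g : E → ℝ} (hg : Measurable g) (hg1 : ∀ x, |g x| ≤ 1) :
    |∫ x, g x ∂gain κ ρ₁ ρ₁ - ∫ x, g x ∂gain κ ρ₂ ρ₂| ≤ 2 * δ := by
  rw [integral_gain (integrable_of_abs_le_one hg hg1),
    integral_gain (integrable_of_abs_le_one hg hg1)]
  exact abs_integral_prod_sub_le hδ hg.stronglyMeasurable.integral_kernel.measurable
    fun q => abs_integral_le_one hg1

/-- The Grönwall iteration for the total variation distance of two solutions. -/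
theorem SolvesIntegrated.abs_integral_sub_le [IsMarkovKernel κ] [IsFiniteMeasure μ]
    [IsMarkovKernel K] [IsMarkovKernel L] (hK : SolvesIntegrated κ M μ K)
    (hL : SolvesIntegrated κ M μ L) (hM : 0 ≤ M) (k : ℕ) :
    ∀ t, 0 ≤ t → ∀ g : E → ℝ, Measurable g → (∀ x, |g x| ≤ 1) →
      |∫ x, g x ∂K t - ∫ x, g x ∂L t| ≤ 2 * ((3 * M * t) ^ k / k.factorial) := by
  induction k with
  | zero =>
    intro t ht g hg hg1
    have h1 := abs_le.1 (abs_integral_le_one (ρ := K t) hg1)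
    have h2 := abs_le.1 (abs_integral_le_one (ρ := L t) hg1)
    rw [abs_le]
    constructor <;> norm_num <;> linarith
  | succ k ih =>
    intro t ht g hg hg1
    rw [hK.integral_eq hM ht hg hg1, hL.integral_eq hM ht hg hg1, add_sub_add_left_eq_sub,
      ← mul_sub]
    have hiK : IntervalIntegrable (fun τ => ∫ x, g x ∂gain κ (K τ) (K τ) - ∫ x, g x ∂K τ)
        volume 0 t := by
      simp only [← comp_prod_apply (κ := κ) (K := K)]
      exact (intervalIntegrable_integral_kernel hg hg1 0 t).sub
        (intervalIntegrable_integral_kernel hg hg1 0 t)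
    have hiL : IntervalIntegrable (fun τ => ∫ x, g x ∂gain κ (L τ) (L τ) - ∫ x, g x ∂L τ)
        volume 0 t := by
      simp only [← comp_prod_apply (κ := κ) (K := L)]
      exact (intervalIntegrable_integral_kernel hg hg1 0 t).sub
        (intervalIntegrable_integral_kernel hg hg1 0 t)
    rw [← intervalIntegral.integral_sub hiK hiL, abs_mul, abs_of_nonneg hM]
    have hbound : ∀ τ ∈ Ioc (0 : ℝ) t,
        ‖(∫ x, g x ∂gain κ (K τ) (K τ) - ∫ x, g x ∂K τ) -
          (∫ x, g x ∂gain κ (L τ) (L τ) - ∫ x, g x ∂L τ)‖ ≤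
        6 * (3 * M) ^ k / k.factorial * τ ^ k := by
      intro τ hτ
      have h1 := abs_le.1 (ih τ hτ.1.le g hg hg1)
      have h2 := abs_le.1 (abs_integral_gain_sub_le (κ := κ) (ih τ hτ.1.le) hg hg1)
      have h3 : 6 * (3 * M) ^ k / k.factorial * τ ^ k =
          3 * (2 * ((3 * M * τ) ^ k / k.factorial)) := by
        rw [mul_pow (3 * M) τ]
        ring
      rw [h3, Real.norm_eq_abs, abs_le]
      constructor <;> linarith
    have h4 := intervalIntegral.norm_integral_le_of_norm_le ht
      (Filter.Eventually.of_forall hbound)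
      ((intervalIntegral.intervalIntegrable_pow (μ := volume) k).const_mul _)
    rw [intervalIntegral.integral_const_mul, integral_pow] at h4
    refine (mul_le_mul_of_nonneg_left h4 hM).trans (le_of_eq ?_)
    rw [Nat.factorial_succ]
    push_cast
    have : (k.factorial : ℝ) ≠ 0 := by positivity
    have : (k : ℝ) + 1 ≠ 0 := by positivity
    rw [zero_pow (by omega), mul_pow (3 * M) t, pow_succ (3 * M)]
    field_simp
    ring

theorem SolvesIntegrated.unique [IsMarkovKernel κ] [IsFiniteMeasure μ]
    [IsMarkovKernel K] [IsMarkovKernel L] (hK : SolvesIntegrated κ M μ K)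
    (hL : SolvesIntegrated κ M μ L) (hM : 0 ≤ M) (ht : 0 ≤ t) : K t = L t := by
  refine Measure.ext fun A hA => ?_
  have h1 : ∀ k : ℕ, |(K t).real A - (L t).real A| ≤ 2 * ((3 * M * t) ^ k / k.factorial) := by
    intro k
    have := hK.abs_integral_sub_le hL hM k t ht (A.indicator 1)
      (measurable_one.indicator hA) fun x => by
        by_cases hx : x ∈ A <;> simp [hx]
    rwa [integral_indicator_one hA, integral_indicator_one hA] at this
  have h2 := (FloorSemiring.tendsto_pow_div_factorial_atTop (3 * M * t)).const_mul 2
  rw [mul_zero] at h2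
  have h3 := ge_of_tendsto' h2 h1
  have h4 : (K t).real A = (L t).real A :=
    sub_eq_zero.1 (abs_eq_zero.1 (le_antisymm h3 (abs_nonneg _)))
  exact (measureReal_eq_measureReal_iff).1 h4

end Uniqueness

/-! ### Weakly continuous paths and trigonometric test functions -/

theorem measurable_of_continuous_integral {X E : Type*} [TopologicalSpace X] [MeasurableSpace X]
    [OpensMeasurableSpace X] [TopologicalSpace E] [HasOuterApproxClosed E] [MeasurableSpace E]
    [BorelSpace E] {F : X → Measure E} [∀ x, IsProbabilityMeasure (F x)]
    (hF : ∀ f : BoundedContinuousFunction E ℝ, Continuous fun x => ∫ v, f v ∂F x) :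
    Measurable F := by
  refine Measurable.measure_of_isPiSystem_of_isProbabilityMeasure
    (S := {s | IsClosed s}) ?_ isPiSystem_isClosed fun A hA => ?_
  · rw [← borel_eq_generateFrom_isClosed]
    exact BorelSpace.measurable_eq
  · have hA' : IsClosed A := hA
    refine ENNReal.measurable_of_tendsto' Filter.atTop
      (f := fun n x => ∫⁻ v, (hA'.apprSeq n v : ℝ≥0∞) ∂F x) (fun n => ?_)
      (tendsto_pi_nhds.2 fun x => HasOuterApproxClosed.tendsto_lintegral_apprSeq hA' (F x))
    have hc : Continuous fun v => ((hA'.apprSeq n v : NNReal) : ℝ) := by fun_prop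
    have h1 := hF (BoundedContinuousFunction.ofNormedAddCommGroup _ hc 1 fun v => by
      simpa using HasOuterApproxClosed.apprSeq_apply_le_one hA' n v)
    have h2 := ENNReal.measurable_ofReal.comp h1.measurable
    convert h2 using 1
    funext x
    simp only [Function.comp, BoundedContinuousFunction.coe_ofNormedAddCommGroup]
    rw [ofReal_integral_eq_lintegral_ofReal]
    · simp
    · exact integrable_of_abs_le_one hc.measurable fun v => by
        simpa using HasOuterApproxClosed.apprSeq_apply_le_one hA' n v
    · exact Filter.Eventually.of_forall fun v => NNReal.coe_nonneg _

section CharFun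

variable {E : Type*} [NormedAddCommGroup E] [InnerProductSpace ℝ E] [MeasurableSpace E]
  [BorelSpace E] [SecondCountableTopology E] [CompleteSpace E]

theorem ext_of_integral_cos_sin {ρ₁ ρ₂ : Measure E} [IsFiniteMeasure ρ₁] [IsFiniteMeasure ρ₂]
    (hc : ∀ ξ : E, ∫ x, Real.cos (inner ℝ x ξ) ∂ρ₁ = ∫ x, Real.cos (inner ℝ x ξ) ∂ρ₂)
    (hs : ∀ ξ : E, ∫ x, Real.sin (inner ℝ x ξ) ∂ρ₁ = ∫ x, Real.sin (inner ℝ x ξ) ∂ρ₂) :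
    ρ₁ = ρ₂ := by
  have key : ∀ (ρ : Measure E) [IsFiniteMeasure ρ] (ξ : E), charFun ρ ξ =
      (∫ x, Real.cos (inner ℝ x ξ) ∂ρ : ℝ) + (∫ x, Real.sin (inner ℝ x ξ) ∂ρ : ℝ) * Complex.I := by
    intro ρ _ ξ
    have i1 : Integrable (fun x => Real.cos (inner ℝ x ξ)) ρ :=
      integrable_of_abs_le_one (by fun_prop) fun x => Real.abs_cos_le_one _
    have i2 : Integrable (fun x => Real.sin (inner ℝ x ξ)) ρ :=
      integrable_of_abs_le_one (by fun_prop) fun x => Real.abs_sin_le_one _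
    rw [charFun_apply, ← integral_complex_ofReal, ← integral_complex_ofReal,
      ← integral_mul_const, ← integral_add i1.ofReal (i2.ofReal.mul_const _)]
    refine integral_congr_ae (Filter.Eventually.of_forall fun x => ?_)
    simp [Complex.exp_mul_I]
  refine Measure.ext_of_charFun (funext fun ξ => ?_)
  rw [key, key, hc, hs]

theorem solvesIntegrated_of_cos_sin {κ : Kernel (E × E) E} [IsMarkovKernel κ] {M : ℝ}
    (hM : 0 ≤ M) {μ : Measure E} [IsFiniteMeasure μ] {K : Kernel ℝ E} [IsMarkovKernel K]
    (h : ∀ g : E → ℝ, (∃ ξ : E, (g = fun x => Real.cos (inner ℝ x ξ)) ∨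
        g = fun x => Real.sin (inner ℝ x ξ)) → ∀ t, 0 ≤ t →
      ∫ x, g x ∂K t - ∫ x, g x ∂μ = ∫ τ in (0 : ℝ)..t,
        M * (∫ x, g x ∂gain κ (K τ) (K τ) - ∫ x, g x ∂K τ)) :
    SolvesIntegrated κ M μ K := by
  intro t ht
  have key : ∀ g : E → ℝ, (∃ ξ : E, (g = fun x => Real.cos (inner ℝ x ξ)) ∨
      g = fun x => Real.sin (inner ℝ x ξ)) →
      ∫ x, g x ∂(K t + ENNReal.ofReal M • (K ∘ₘ volume.restrict (Ioc 0 t))) =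
      ∫ x, g x ∂(μ + ENNReal.ofReal M • ((κ ∘ₖ (K ×ₖ K)) ∘ₘ volume.restrict (Ioc 0 t))) := by
    intro g hg
    have hgm : Measurable g := by rcases hg with ⟨ξ, rfl | rfl⟩ <;> fun_prop
    have hg1 : ∀ x, |g x| ≤ 1 := by
      rcases hg with ⟨ξ, rfl | rfl⟩
      exacts [fun x => Real.abs_cos_le_one _, fun x => Real.abs_sin_le_one _]
    have h1 := h g hg t ht
    simp only [← comp_prod_apply (κ := κ) (K := K)] at h1
    rw [integral_add_smul_bind hM ht _ hgm hg1, integral_add_smul_bind hM ht _ hgm hg1]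
    rw [intervalIntegral.integral_const_mul, intervalIntegral.integral_sub
      (intervalIntegrable_integral_kernel hgm hg1 0 t)
      (intervalIntegrable_integral_kernel hgm hg1 0 t)] at h1
    linarith
  have hfin : ∀ (ρ : Measure E) (J : Kernel ℝ E), IsFiniteMeasure ρ → IsMarkovKernel J →
      IsFiniteMeasure (ρ + ENNReal.ofReal M • (J ∘ₘ volume.restrict (Ioc 0 t))) := by
    intro ρ J _ _
    have := Measure.smul_finite (J ∘ₘ volume.restrict (Ioc 0 t)) (ENNReal.ofReal_ne_top (r := M))
    infer_instance
  have := hfin (K t) K inferInstance inferInstance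
  have := hfin μ (κ ∘ₖ (K ×ₖ K)) inferInstance inferInstance
  exact ext_of_integral_cos_sin (fun ξ => key _ ⟨ξ, Or.inl rfl⟩) fun ξ => key _ ⟨ξ, Or.inr rfl⟩

end CharFun

end

end InelasticBoltzmann

namespace InelasticBoltzmann

open ProbabilityTheory
open scoped ENNReal Pointwise

noncomputable section

/-! ### Rotation invariance of the surface measure -/

instance isFiniteMeasure_surfaceMeasure : IsFiniteMeasure surfaceMeasure := by
  unfold surfaceMeasure; infer_instance

/-- The action of a linear isometry on the unit sphere. -/
def rotateSphere (R : V ≃ₗᵢ[ℝ] V) (σ : S2) : S2 :=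
  ⟨R σ, by simp⟩

theorem measurable_rotateSphere (R : V ≃ₗᵢ[ℝ] V) : Measurable (rotateSphere R) :=
  (R.continuous.measurable.comp measurable_subtype_coe).subtype_mk

theorem map_rotateSphere (R : V ≃ₗᵢ[ℝ] V) :
    surfaceMeasure.map (rotateSphere R) = surfaceMeasure := by
  refine Measure.ext fun s hs => ?_
  rw [Measure.map_apply (measurable_rotateSphere R) hs]
  unfold surfaceMeasure
  rw [Measure.toSphere_apply' _ hs, Measure.toSphere_apply' _ (measurable_rotateSphere R hs)]
  have h1 : (Ioo (0 : ℝ) 1 • (Subtype.val '' (rotateSphere R ⁻¹' s)) : Set V) =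
      R ⁻¹' (Ioo (0 : ℝ) 1 • (Subtype.val '' s)) := by
    ext x
    simp only [Set.mem_smul, mem_image, mem_preimage, exists_exists_and_eq_and]
    constructor
    · rintro ⟨c, hc, σ, hσ, rfl⟩
      exact ⟨c, hc, rotateSphere R σ, hσ, by simp [rotateSphere]⟩
    · rintro ⟨c, hc, σ, hσ, hx⟩
      have h2 : rotateSphere R (rotateSphere R.symm σ) = σ := by
        ext1; simp [rotateSphere]
      refine ⟨c, hc, rotateSphere R.symm σ, by rwa [h2], R.injective ?_⟩
      rw [← hx]
      simp [rotateSphere]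
  have h3 : MeasurePreserving R.toMeasurableEquiv (volume : Measure V) volume :=
    R.measurePreserving
  rw [h1]
  congr 1
  exact h3.measure_preimage_equiv _

theorem lintegral_inner_surfaceMeasure {f : ℝ → ℝ≥0∞} (hf : Measurable f) {k l : V}
    (hkl : ‖k‖ = ‖l‖) :
    ∫⁻ σ : S2, f (inner ℝ k (σ : V)) ∂surfaceMeasure =
      ∫⁻ σ : S2, f (inner ℝ l (σ : V)) ∂surfaceMeasure := by
  let R : V ≃ₗᵢ[ℝ] V := (ℝ ∙ (k - l))ᗮ.reflection
  have hR : R k = l := Submodule.reflection_sub hkl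
  conv_rhs => rw [← map_rotateSphere R]
  rw [lintegral_map (f := fun σ : S2 => f (inner ℝ l (σ : V))) (hf.comp (by fun_prop))
    (measurable_rotateSphere R)]
  refine lintegral_congr fun σ => ?_
  rw [← hR]
  simp [rotateSphere]

/-! ### Inelastic collisions: momentum and energy -/

section Collision

variable {e : ℝ} {v w σ : V}

theorem postV_add_postW : postV e v w σ + postW e v w σ = v + w := by
  unfold postV postW
  module

theorem norm_sq_postV_add_norm_sq_postW_le (he0 : 0 < e) (he1 : e ≤ 1) (hσ : ‖σ‖ = 1) :
    ‖postV e v w σ‖ ^ 2 + ‖postW e v w σ‖ ^ 2 ≤ ‖v‖ ^ 2 + ‖w‖ ^ 2 := by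
  set m : V := (1 / 2 : ℝ) • (v + w)
  set u : V := ((1 - e) / 4) • (v - w) + ((1 + e) / 4 * ‖v - w‖) • σ with hu
  have h1 : postV e v w σ = m + u := by simp only [postV, m, u]; abel
  have h2 : postW e v w σ = m - u := by simp only [postW, m, u]; abel
  have h3 : ‖u‖ ≤ ‖v - w‖ / 2 := by
    refine (norm_add_le _ _).trans ?_
    rw [norm_smul, norm_smul, hσ, Real.norm_eq_abs, Real.norm_eq_abs,
      abs_of_nonneg (by linarith), abs_of_nonneg (by positivity)]
    linarith
  have h4 : ‖m‖ = ‖v + w‖ / 2 := by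
    simp only [m, norm_smul]
    norm_num
    ring
  have p1 := parallelogram_law_with_norm ℝ m u
  have p2 := parallelogram_law_with_norm ℝ v w
  rw [h1, h2]
  rw [h4] at p1
  have h5 : ‖u‖ * ‖u‖ ≤ (‖v - w‖ / 2) * (‖v - w‖ / 2) := by gcongr
  nlinarith

/-- The growth `1 + |v|^α`, `α ≤ 2`, is at most doubled by a collision, as energy does not
increase and `r ↦ r^{α/2}` is subadditive. -/
theorem one_add_rpow_postV_add_postW_le (he0 : 0 < e) (he1 : e ≤ 1) (hσ : ‖σ‖ = 1) {α : ℝ}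
    (h0 : 0 < α) (h2 : α ≤ 2) :
    (1 + ‖postV e v w σ‖ ^ α) + (1 + ‖postW e v w σ‖ ^ α) ≤
      2 * ((1 + ‖v‖ ^ α) + (1 + ‖w‖ ^ α)) := by
  have hE := norm_sq_postV_add_norm_sq_postW_le (v := v) (w := w) he0 he1 hσ
  have hpow : ∀ x : V, (‖x‖ ^ 2) ^ (α / 2) = ‖x‖ ^ α := by
    intro x
    rw [← Real.rpow_natCast, ← Real.rpow_mul (norm_nonneg x)]
    congr 1
    push_cast
    ring
  have key : ∀ x : V, ‖x‖ ^ 2 ≤ ‖v‖ ^ 2 + ‖w‖ ^ 2 → ‖x‖ ^ α ≤ ‖v‖ ^ α + ‖w‖ ^ α := by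
    intro x hx
    rw [← hpow x, ← hpow v, ← hpow w]
    exact (Real.rpow_le_rpow (by positivity) hx (by positivity)).trans
      (Real.rpow_add_le_add_rpow (by positivity) (by positivity) (by positivity) (by linarith))
  have k1 := key (postV e v w σ) (by nlinarith [sq_nonneg ‖postW e v w σ‖])
  have k2 := key (postW e v w σ) (by nlinarith [sq_nonneg ‖postV e v w σ‖])
  linarith

theorem measurable_postV : Measurable fun x : (V × V) × S2 => postV e x.1.1 x.1.2 x.2 := by
  unfold postV
  fun_prop

theorem measurable_postW : Measurable fun x : (V × V) × S2 => postW e x.1.1 x.1.2 x.2 := by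
  unfold postW
  fun_prop

end Collision

theorem measurable_postV_sphere {e : ℝ} (q : V × V) :
    Measurable fun σ : S2 => postV e q.1 q.2 σ := by
  unfold postV
  fun_prop

theorem measurable_postW_sphere {e : ℝ} (q : V × V) :
    Measurable fun σ : S2 => postW e q.1 q.2 σ := by
  unfold postW
  fun_prop

/-! ### The Markov kernel of a collision kernel with bounded rate -/

/-- A measurable non-negative collision kernel whose total rate `∫ B(v, w, σ) dσ` is at most
`M`, uniformly in the velocities. -/
structure HasRateBound (B : V → V → V → ℝ) (M : ℝ) : Prop where
  pos : 0 < M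
  measurable : Measurable fun x : (V × V) × S2 => B x.1.1 x.1.2 x.2
  nonneg : ∀ v w, ∀ σ : S2, 0 ≤ B v w σ
  lintegral_le : ∀ v w, ∫⁻ σ : S2, ENNReal.ofReal (B v w σ) ∂surfaceMeasure ≤ ENNReal.ofReal M

/-- The law of one of the two particles, chosen at random, after an event of a clock of rate `M`:
a collision with intensity `B dσ`, and with the remaining intensity nothing happens. -/
def collisionMeasure (e : ℝ) (B : V → V → V → ℝ) (M : ℝ) (q : V × V) : Measure V :=
  (2 * ENNReal.ofReal M)⁻¹ •
    ((surfaceMeasure.withDensity fun σ : S2 => ENNReal.ofReal (B q.1 q.2 σ)).map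
        (fun σ : S2 => postV e q.1 q.2 σ) +
      (surfaceMeasure.withDensity fun σ : S2 => ENNReal.ofReal (B q.1 q.2 σ)).map
        (fun σ : S2 => postW e q.1 q.2 σ) +
      (ENNReal.ofReal M - ∫⁻ σ : S2, ENNReal.ofReal (B q.1 q.2 σ) ∂surfaceMeasure) •
        (Measure.dirac q.1 + Measure.dirac q.2))

namespace HasRateBound

variable {e : ℝ} {B : V → V → V → ℝ} {M : ℝ} (hB : HasRateBound B M)
include hB

theorem measurable_sphere (q : V × V) : Measurable fun σ : S2 => B q.1 q.2 σ :=
  hB.measurable.comp (measurable_prodMk_left (x := q))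

theorem two_mul_ofReal_ne_zero : 2 * ENNReal.ofReal M ≠ 0 := by
  simp [hB.pos]

theorem lintegral_collisionMeasure {f : V → ℝ≥0∞} (hf : Measurable f) (q : V × V) :
    ∫⁻ x, f x ∂collisionMeasure e B M q = (2 * ENNReal.ofReal M)⁻¹ *
      (∫⁻ σ : S2, ENNReal.ofReal (B q.1 q.2 σ) *
          (f (postV e q.1 q.2 σ) + f (postW e q.1 q.2 σ)) ∂surfaceMeasure +
        (ENNReal.ofReal M - ∫⁻ σ : S2, ENNReal.ofReal (B q.1 q.2 σ) ∂surfaceMeasure) *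
          (f q.1 + f q.2)) := by
  have mB : Measurable fun σ : S2 => ENNReal.ofReal (B q.1 q.2 σ) :=
    (hB.measurable_sphere q).ennreal_ofReal
  have mV : Measurable fun σ : S2 => postV e q.1 q.2 σ := measurable_postV_sphere q
  have mW : Measurable fun σ : S2 => postW e q.1 q.2 σ := measurable_postW_sphere q
  have eV : ∫⁻ σ : S2, f (postV e q.1 q.2 σ) ∂(surfaceMeasure.withDensity fun σ : S2 =>
      ENNReal.ofReal (B q.1 q.2 σ)) =
      ∫⁻ σ : S2, ENNReal.ofReal (B q.1 q.2 σ) * f (postV e q.1 q.2 σ) ∂surfaceMeasure :=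
    lintegral_withDensity_eq_lintegral_mul _ mB (hf.comp mV)
  have eW : ∫⁻ σ : S2, f (postW e q.1 q.2 σ) ∂(surfaceMeasure.withDensity fun σ : S2 =>
      ENNReal.ofReal (B q.1 q.2 σ)) =
      ∫⁻ σ : S2, ENNReal.ofReal (B q.1 q.2 σ) * f (postW e q.1 q.2 σ) ∂surfaceMeasure :=
    lintegral_withDensity_eq_lintegral_mul _ mB (hf.comp mW)
  have mBV : Measurable fun σ : S2 => ENNReal.ofReal (B q.1 q.2 σ) * f (postV e q.1 q.2 σ) :=
    mB.mul (hf.comp mV)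
  rw [collisionMeasure, lintegral_smul_measure, lintegral_add_measure, lintegral_add_measure,
    lintegral_smul_measure, lintegral_add_measure, lintegral_map hf mV, lintegral_map hf mW,
    lintegral_dirac' _ hf, lintegral_dirac' _ hf, smul_eq_mul, smul_eq_mul, eV, eW,
    ← lintegral_add_left mBV]
  simp only [mul_add]

theorem measurable_collisionMeasure : Measurable (collisionMeasure e B M) := by
  refine Measure.measurable_of_measurable_coe _ fun A hA => ?_
  have hf : Measurable (A.indicator (1 : V → ℝ≥0∞)) := measurable_one.indicator hA
  have h1 : (fun q => collisionMeasure e B M q A) =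
      fun q => ∫⁻ x, A.indicator 1 x ∂collisionMeasure e B M q := by
    funext q
    rw [lintegral_indicator_one hA]
  rw [h1]
  simp only [hB.lintegral_collisionMeasure hf]
  have mB := hB.measurable.ennreal_ofReal
  have m1 : Measurable fun q : V × V => ∫⁻ σ : S2, ENNReal.ofReal (B q.1 q.2 σ) *
      (A.indicator (1 : V → ℝ≥0∞) (postV e q.1 q.2 σ) +
        A.indicator (1 : V → ℝ≥0∞) (postW e q.1 q.2 σ)) ∂surfaceMeasure :=
    (mB.mul ((hf.comp measurable_postV).add (hf.comp measurable_postW))).lintegral_prod_right'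
  have m2 : Measurable fun q : V × V =>
      ∫⁻ σ : S2, ENNReal.ofReal (B q.1 q.2 σ) ∂surfaceMeasure := mB.lintegral_prod_right'
  exact (m1.add ((measurable_const.sub m2).mul
    ((hf.comp measurable_fst).add (hf.comp measurable_snd)))).const_mul _

/-- The measures `collisionMeasure e B M` as a kernel. -/
def kernel (e : ℝ) : Kernel (V × V) V := ⟨collisionMeasure e B M, hB.measurable_collisionMeasure⟩

theorem kernel_apply (q : V × V) : hB.kernel e q = collisionMeasure e B M q := rfl

/-- If every collision multiplies the sum of `p` over the two particles by at most `c ≥ 1`, then so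
does a tick of the clock, on average; the factor `2⁻¹` comes from choosing one of the particles. -/
theorem lintegral_kernel_le {p : V → ℝ≥0∞} (hp : Measurable p) {c : ℝ≥0∞} (hc : 1 ≤ c)
    (h : ∀ v w, ∀ σ : S2, p (postV e v w σ) + p (postW e v w σ) ≤ c * (p v + p w)) (q : V × V) :
    ∫⁻ x, p x ∂hB.kernel e q ≤ 2⁻¹ * c * (p q.1 + p q.2) := by
  rw [kernel_apply, hB.lintegral_collisionMeasure hp]
  set Λ := ∫⁻ σ : S2, ENNReal.ofReal (B q.1 q.2 σ) ∂surfaceMeasure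
  have mB : Measurable fun σ : S2 => ENNReal.ofReal (B q.1 q.2 σ) :=
    (hB.measurable_sphere q).ennreal_ofReal
  have h1 : ∫⁻ σ : S2, ENNReal.ofReal (B q.1 q.2 σ) *
      (p (postV e q.1 q.2 σ) + p (postW e q.1 q.2 σ)) ∂surfaceMeasure ≤
      Λ * (c * (p q.1 + p q.2)) := by
    rw [← lintegral_mul_const _ mB]
    exact lintegral_mono fun σ => mul_le_mul_right (h _ _ σ) _
  have h2 : (ENNReal.ofReal M - Λ) * (p q.1 + p q.2) ≤
      (ENNReal.ofReal M - Λ) * (c * (p q.1 + p q.2)) :=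
    mul_le_mul_right (le_mul_of_one_le_left' hc) _
  calc _ ≤ (2 * ENNReal.ofReal M)⁻¹ * (Λ * (c * (p q.1 + p q.2)) +
        (ENNReal.ofReal M - Λ) * (c * (p q.1 + p q.2))) :=
        mul_le_mul_right (add_le_add h1 h2) _
    _ = (2 * ENNReal.ofReal M)⁻¹ * ENNReal.ofReal M * (c * (p q.1 + p q.2)) := by
        rw [← add_mul, add_tsub_cancel_of_le (hB.lintegral_le _ _), mul_assoc]
    _ = 2⁻¹ * c * (p q.1 + p q.2) := by
        rw [ENNReal.mul_inv (by simp) (by simp), mul_assoc 2⁻¹,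
          ENNReal.inv_mul_cancel (by simp [hB.pos]) (by simp), mul_one, mul_assoc]

theorem isMarkovKernel_kernel : IsMarkovKernel (hB.kernel e) := by
  refine ⟨fun q => ⟨?_⟩⟩
  have h := hB.lintegral_collisionMeasure (e := e) (f := 1) measurable_one q
  simp only [Pi.one_apply, lintegral_one] at h
  have mB : Measurable fun σ : S2 => ENNReal.ofReal (B q.1 q.2 σ) :=
    (hB.measurable_sphere q).ennreal_ofReal
  rw [kernel_apply, h, lintegral_mul_const _ mB, ← add_mul,
    add_tsub_cancel_of_le (hB.lintegral_le _ _), one_add_one_eq_two, mul_comm _ (2 : ℝ≥0∞)]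
  exact ENNReal.inv_mul_cancel hB.two_mul_ofReal_ne_zero (by finiteness)

theorem integrable_surface (q : V × V) :
    Integrable (fun σ : S2 => B q.1 q.2 σ) surfaceMeasure := by
  have mB : Measurable fun σ : S2 => B q.1 q.2 σ := hB.measurable_sphere q
  refine ⟨mB.aestronglyMeasurable, ?_⟩
  refine lt_of_le_of_lt (le_of_eq ?_) ((hB.lintegral_le q.1 q.2).trans_lt ENNReal.ofReal_lt_top)
  refine lintegral_congr fun σ => ?_
  rw [Real.enorm_eq_ofReal (hB.nonneg _ _ σ)]

/-- The angular integral of the weak collision operator in terms of the Markov kernel. -/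
theorem integral_surface_eq {ψ : V → ℝ} (hψ : Measurable ψ) {q : V × V} {C : ℝ}
    (hV : ∀ σ : S2, |ψ (postV e q.1 q.2 σ)| ≤ C) (hW : ∀ σ : S2, |ψ (postW e q.1 q.2 σ)| ≤ C) :
    ∫ σ : S2, B q.1 q.2 σ * (ψ (postV e q.1 q.2 σ) + ψ (postW e q.1 q.2 σ) - ψ q.1 - ψ q.2)
      ∂surfaceMeasure = 2 * M * ∫ x, ψ x ∂hB.kernel e q - M * (ψ q.1 + ψ q.2) := by
  have mBr : Measurable fun σ : S2 => B q.1 q.2 σ := hB.measurable_sphere q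
  have mB := mBr.ennreal_ofReal
  have mV : Measurable fun σ : S2 => postV e q.1 q.2 σ := measurable_postV_sphere q
  have mW : Measurable fun σ : S2 => postW e q.1 q.2 σ := measurable_postW_sphere q
  have iB := hB.integrable_surface q
  have iV : Integrable (fun σ : S2 => B q.1 q.2 σ * ψ (postV e q.1 q.2 σ)) surfaceMeasure :=
    iB.mul_bdd (hψ.comp mV).aestronglyMeasurable (Filter.Eventually.of_forall hV)
  have iW : Integrable (fun σ : S2 => B q.1 q.2 σ * ψ (postW e q.1 q.2 σ)) surfaceMeasure :=
    iB.mul_bdd (hψ.comp mW).aestronglyMeasurable (Filter.Eventually.of_forall hW)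
  have hΛ : ∫⁻ σ : S2, ENNReal.ofReal (B q.1 q.2 σ) ∂surfaceMeasure =
      ENNReal.ofReal (∫ σ : S2, B q.1 q.2 σ ∂surfaceMeasure) :=
    (ofReal_integral_eq_lintegral_ofReal iB
      (Filter.Eventually.of_forall fun σ => hB.nonneg _ _ σ)).symm
  have hΛ0 : 0 ≤ ∫ σ : S2, B q.1 q.2 σ ∂surfaceMeasure :=
    integral_nonneg fun σ => hB.nonneg _ _ σ
  have hΛM : ∫ σ : S2, B q.1 q.2 σ ∂surfaceMeasure ≤ M := by
    have := hB.lintegral_le q.1 q.2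
    rw [hΛ] at this
    exact (ENNReal.ofReal_le_ofReal_iff hB.pos.le).1 this
  -- the push-forwards of the density `B`
  have hd : ∀ T : S2 → V, Measurable T →
      Integrable (fun σ : S2 => B q.1 q.2 σ * ψ (T σ)) surfaceMeasure →
      Integrable ψ ((surfaceMeasure.withDensity fun σ : S2 => ENNReal.ofReal (B q.1 q.2 σ)).map T) ∧
      ∫ x, ψ x ∂(surfaceMeasure.withDensity fun σ : S2 => ENNReal.ofReal (B q.1 q.2 σ)).map T =
        ∫ σ : S2, B q.1 q.2 σ * ψ (T σ) ∂surfaceMeasure := by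
    intro T hT hi
    have hr : ∀ σ : S2, (ENNReal.ofReal (B q.1 q.2 σ)).toReal = B q.1 q.2 σ :=
      fun σ => ENNReal.toReal_ofReal (hB.nonneg _ _ σ)
    constructor
    · rw [integrable_map_measure hψ.aestronglyMeasurable hT.aemeasurable,
        integrable_withDensity_iff mB (Filter.Eventually.of_forall fun σ => by simp)]
      simpa [hr, mul_comm] using hi
    · rw [integral_map hT.aemeasurable hψ.aestronglyMeasurable,
        integral_withDensity_eq_integral_toReal_smul mB
          (Filter.Eventually.of_forall fun σ => by simp)]
      simp [hr]
  obtain ⟨jV, eV⟩ := hd _ mV iV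
  obtain ⟨jW, eW⟩ := hd _ mW iW
  have jd : ∀ x : V, Integrable ψ (Measure.dirac x) := fun x =>
    integrable_dirac' hψ.stronglyMeasurable (by simp)
  have hker : ∫ x, ψ x ∂hB.kernel e q = (2 * M)⁻¹ *
      (∫ σ : S2, B q.1 q.2 σ * ψ (postV e q.1 q.2 σ) ∂surfaceMeasure +
        ∫ σ : S2, B q.1 q.2 σ * ψ (postW e q.1 q.2 σ) ∂surfaceMeasure +
        (M - ∫ σ : S2, B q.1 q.2 σ ∂surfaceMeasure) * (ψ q.1 + ψ q.2)) := by
    rw [kernel_apply, collisionMeasure, integral_smul_measure, integral_add_measure (jV.add_measure jW)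
      (((jd _).add_measure (jd _)).smul_measure (by finiteness)), integral_add_measure jV jW,
      integral_smul_measure, integral_add_measure (jd _) (jd _), eV, eW,
      integral_dirac' _ _ hψ.stronglyMeasurable, integral_dirac' _ _ hψ.stronglyMeasurable, hΛ,
      ← ENNReal.ofReal_sub _ hΛ0, ENNReal.toReal_ofReal (sub_nonneg.2 hΛM), smul_eq_mul,
      smul_eq_mul, ENNReal.toReal_inv, ENNReal.toReal_mul, ENNReal.toReal_ofReal hB.pos.le]
    simp
  have hsplit : ∀ σ : S2, B q.1 q.2 σ *
      (ψ (postV e q.1 q.2 σ) + ψ (postW e q.1 q.2 σ) - ψ q.1 - ψ q.2) =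
      B q.1 q.2 σ * ψ (postV e q.1 q.2 σ) + B q.1 q.2 σ * ψ (postW e q.1 q.2 σ) -
        B q.1 q.2 σ * (ψ q.1 + ψ q.2) := fun σ => by ring
  have iVW : Integrable (fun σ : S2 => B q.1 q.2 σ * ψ (postV e q.1 q.2 σ) +
      B q.1 q.2 σ * ψ (postW e q.1 q.2 σ)) surfaceMeasure := iV.add iW
  simp only [hsplit]
  rw [integral_sub iVW (iB.mul_const _), integral_add iV iW, integral_mul_const, hker]
  have := hB.pos.ne'
  field_simp
  ring

/-- For bounded `ψ`, the weak collision operator is `M (∫ ψ d gain(F, F) - ∫ ψ dF)`. -/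
theorem weakCollision_eq {F : Measure V} [IsProbabilityMeasure F] {ψ : V → ℝ}
    (hψ : Measurable ψ) {C : ℝ} (hC : ∀ x, |ψ x| ≤ C) :
    weakCollision e B F ψ = M * (∫ x, ψ x ∂gain (hB.kernel e) F F - ∫ x, ψ x ∂F) := by
  have := hB.isMarkovKernel_kernel (e := e)
  have bdd : ∀ (X : Type) [MeasurableSpace X] (ρ : Measure X) [IsFiniteMeasure ρ] (g : X → ℝ),
      Measurable g → (∀ x, |g x| ≤ C) → Integrable g ρ := fun X _ ρ _ g hg hgC =>
    Integrable.of_bound hg.aestronglyMeasurable C (Filter.Eventually.of_forall hgC)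
  have iψ : Integrable ψ F := bdd _ _ _ hψ hC
  have mκ : Measurable fun q : V × V => ∫ x, ψ x ∂hB.kernel e q :=
    hψ.stronglyMeasurable.integral_kernel.measurable
  have bκ : ∀ q, |∫ x, ψ x ∂hB.kernel e q| ≤ C := fun q => by
    simpa using norm_integral_le_of_norm_le_const (μ := hB.kernel e q) (f := ψ) (C := C)
      (Filter.Eventually.of_forall hC)
  have iκ : Integrable (fun q : V × V => ∫ x, ψ x ∂hB.kernel e q) (F.prod F) := bdd _ _ _ mκ bκ
  have hang : ∀ v w : V, ∫ σ : S2,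
      B v w σ * (ψ (postV e v w σ) + ψ (postW e v w σ) - ψ v - ψ w) ∂surfaceMeasure =
      2 * M * ∫ x, ψ x ∂hB.kernel e (v, w) - M * (ψ v + ψ w) := fun v w =>
    hB.integral_surface_eq hψ (q := (v, w)) (fun σ => hC _) fun σ => hC _
  unfold weakCollision
  simp only [hang]
  have i1 : Integrable (fun q : V × V => 2 * M * ∫ x, ψ x ∂hB.kernel e q) (F.prod F) :=
    iκ.const_mul _
  have i2 : Integrable (fun q : V × V => M * (ψ q.1 + ψ q.2)) (F.prod F) :=
    ((iψ.comp_fst F).add (iψ.comp_snd F)).const_mul _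
  rw [← integral_prod (fun q : V × V => 2 * M * ∫ x, ψ x ∂hB.kernel e q - M * (ψ q.1 + ψ q.2))
    (i1.sub i2), integral_sub i1 i2, integral_const_mul, integral_const_mul,
    integral_add (iψ.comp_fst F) (iψ.comp_snd F), integral_fun_fst, integral_fun_snd,
    integral_gain (bdd _ _ _ hψ hC)]
  simp
  ring

/-- Momentum is conserved on average by the collision clock. -/
theorem integral_coord_kernel (he0 : 0 < e) (he1 : e ≤ 1) (j : Fin 3) (q : V × V) :
    ∫ x : V, x j ∂hB.kernel e q = 2⁻¹ * (q.1 j + q.2 j) := by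
  have hbound : ∀ x : V, ‖x‖ ^ 2 ≤ ‖q.1‖ ^ 2 + ‖q.2‖ ^ 2 →
      |x j| ≤ Real.sqrt (‖q.1‖ ^ 2 + ‖q.2‖ ^ 2) := fun x hx =>
    (PiLp.norm_apply_le x j).trans (Real.le_sqrt_of_sq_le hx)
  have hE : ∀ σ : S2, _ := fun σ : S2 =>
    norm_sq_postV_add_norm_sq_postW_le (v := q.1) (w := q.2) he0 he1
      (mem_sphere_zero_iff_norm.1 σ.2)
  have h := hB.integral_surface_eq (e := e) (ψ := fun x : V => x j) (by fun_prop) (q := q)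
    (C := Real.sqrt (‖q.1‖ ^ 2 + ‖q.2‖ ^ 2))
    (fun σ => hbound _ (by nlinarith [hE σ, sq_nonneg ‖postW e q.1 q.2 σ‖]))
    (fun σ => hbound _ (by nlinarith [hE σ, sq_nonneg ‖postV e q.1 q.2 σ‖]))
  have h0 : ∀ σ : S2, B q.1 q.2 σ * ((postV e q.1 q.2 σ) j + (postW e q.1 q.2 σ) j -
      q.1 j - q.2 j) = 0 := by
    intro σ
    have h1 := congrArg (fun x : V => x j)
      (postV_add_postW (e := e) (v := q.1) (w := q.2) (σ := (σ : V)))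
    simp only [PiLp.add_apply] at h1
    rw [h1]
    ring
  simp only [h0, integral_zero] at h
  have hM := hB.pos.ne'
  have h2 : M * (2 * ∫ x : V, x j ∂hB.kernel e q) = M * (q.1 j + q.2 j) := by linarith
  linarith [mul_left_cancel₀ hM h2]

/-- The growth `C (1 + |v|^α)` is a moment weight. -/
theorem isMomentWeight (he0 : 0 < e) (he1 : e ≤ 1) {α : ℝ} (h0 : 0 < α) (h2 : α ≤ 2)
    {F₀ : Measure V} [IsProbabilityMeasure F₀] (hF₀ : Integrable (fun v : V => ‖v‖ ^ α) F₀)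
    (C : ℝ) : IsMomentWeight (hB.kernel e) F₀ fun v => ENNReal.ofReal (C * (1 + ‖v‖ ^ α)) where
  measurable := by fun_prop
  lintegral_le q := by
    rcases lt_or_ge C 0 with hC | hC
    · have : ∀ v : V, ENNReal.ofReal (C * (1 + ‖v‖ ^ α)) = 0 := fun v =>
        ENNReal.ofReal_of_nonpos (mul_nonpos_of_nonpos_of_nonneg hC.le (by positivity))
      simp [this]
    · have h := hB.lintegral_kernel_le (e := e)
        (p := fun v => ENNReal.ofReal (C * (1 + ‖v‖ ^ α))) (by fun_prop) (c := 2) (by norm_num)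
        (fun v w σ => ?_) q
      · rwa [ENNReal.inv_mul_cancel (by simp) (by simp), one_mul] at h
      · have h2' : (2 : ℝ≥0∞) = ENNReal.ofReal 2 := by simp
        refine le_of_le_of_eq ?_ (congrArg (· * (ENNReal.ofReal (C * (1 + ‖v‖ ^ α)) +
          ENNReal.ofReal (C * (1 + ‖w‖ ^ α)))) h2'.symm)
        rw [← ENNReal.ofReal_add (by positivity) (by positivity),
          ← ENNReal.ofReal_add (by positivity) (by positivity), ← ENNReal.ofReal_mul (by simp)]
        refine ENNReal.ofReal_le_ofReal ?_
        have := one_add_rpow_postV_add_postW_le (v := v) (w := w) he0 he1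
          (mem_sphere_zero_iff_norm.1 σ.2) h0 h2
        nlinarith
  ne_top := by
    have hi : Integrable (fun v : V => C * (1 + ‖v‖ ^ α)) F₀ :=
      ((integrable_const 1).add hF₀).const_mul C
    exact ne_top_of_le_ne_top hi.2.ne (lintegral_mono fun v => Real.ofReal_le_enorm _)

end HasRateBound

/-! ### The cutoff kernel has bounded rate -/

theorem exists_hasRateBound {γ : ℝ} (hγ : 0 < γ) {n : ℕ} (hn : 1 ≤ n) {b φ : ℝ → ℝ}
    (hb : IsCutoffAngularKernel b) (hφ : IsCutoffProfile φ) :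
    ∃ M, HasRateBound (collisionKernel b (kineticKernel γ φ n)) M := by
  have hn0 : (0 : ℝ) < n := by exact_mod_cast hn
  have hΦ0 : ∀ r : ℝ, 0 ≤ r → 0 ≤ kineticKernel γ φ n r := fun r hr =>
    mul_nonneg (by positivity) (hφ.nonneg _ (by positivity))
  have hΦle : ∀ r : ℝ, 0 ≤ r → kineticKernel γ φ n r ≤ (2 * n) ^ γ := by
    intro r hr
    unfold kineticKernel
    rcases le_or_gt (r / n) 2 with h | h
    · have h1 : r ≤ 2 * n := by rwa [div_le_iff₀ hn0] at h
      calc r ^ γ * φ (r / n) ≤ (2 * n) ^ γ * 1 := by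
            gcongr
            · exact hφ.nonneg _ (by positivity)
            · exact hφ.le_one _ (by positivity)
        _ = _ := mul_one _
    · rw [hφ.eq_zero _ h, mul_zero]
      positivity
  have hinner : ∀ v w : V, ∀ σ : S2,
      inner ℝ ((‖v - w‖)⁻¹ • (v - w)) (σ : V) ∈ Icc (-1 : ℝ) 1 := by
    intro v w σ
    refine abs_le.1 ((abs_real_inner_le_norm _ _).trans ?_)
    rw [norm_smul, norm_inv, norm_norm, mem_sphere_zero_iff_norm.1 σ.2, mul_one]
    exact inv_mul_le_one
  obtain ⟨k, hk⟩ := exists_norm_eq V (zero_le_one' ℝ)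
  set I := ∫⁻ σ : S2, ENNReal.ofReal (b (inner ℝ k (σ : V))) ∂surfaceMeasure
  have hItop : I ≠ ⊤ := ne_top_of_le_ne_top (hb.integrable k hk).2.ne
    (lintegral_mono fun σ => Real.ofReal_le_enorm _)
  have mb : Measurable fun x => ENNReal.ofReal (b x) := hb.measurable.ennreal_ofReal
  refine ⟨I.toReal * (2 * n) ^ γ + 1, by positivity, ?_, fun v w σ => ?_, fun v w => ?_⟩
  · unfold collisionKernel kineticKernel
    have h1 : Measurable fun x : V => φ ‖x‖ := hφ.contDiff.continuous.measurable
    have h2 : ∀ x : (V × V) × S2, φ (‖x.1.1 - x.1.2‖ / n) =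
        (fun x : V => φ ‖x‖) ((n : ℝ)⁻¹ • (x.1.1 - x.1.2)) := by
      intro x
      simp only [norm_smul, norm_inv, Real.norm_natCast]
      rw [div_eq_inv_mul]
    simp only [h2]
    refine (hb.measurable.comp (by fun_prop)).mul (Measurable.mul (by fun_prop) ?_)
    exact h1.comp (by fun_prop)
  · exact mul_nonneg (hb.nonneg _ (hinner v w σ)) (hΦ0 _ (norm_nonneg _))
  · rcases eq_or_ne v w with rfl | hvw
    · -- particles with equal velocities do not collide, as `Φ(0) = 0`
      simp [collisionKernel, kineticKernel, Real.zero_rpow hγ.ne']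
    · have hunit : ‖(‖v - w‖)⁻¹ • (v - w)‖ = ‖k‖ := by
        rw [hk, norm_smul, norm_inv, norm_norm,
          inv_mul_cancel₀ (norm_ne_zero_iff.2 (sub_ne_zero.2 hvw))]
      calc ∫⁻ σ : S2, ENNReal.ofReal (collisionKernel b (kineticKernel γ φ n) v w σ)
            ∂surfaceMeasure
          ≤ ∫⁻ σ : S2, ENNReal.ofReal (b (inner ℝ ((‖v - w‖)⁻¹ • (v - w)) (σ : V))) *
              ENNReal.ofReal ((2 * n) ^ γ) ∂surfaceMeasure := by
            refine lintegral_mono fun σ => ?_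
            rw [← ENNReal.ofReal_mul (hb.nonneg _ (hinner v w σ))]
            exact ENNReal.ofReal_le_ofReal (mul_le_mul_of_nonneg_left
              (hΦle _ (norm_nonneg _)) (hb.nonneg _ (hinner v w σ)))
        _ = I * ENNReal.ofReal ((2 * n) ^ γ) := by
            have m1 : Measurable fun σ : S2 =>
                ENNReal.ofReal (b (inner ℝ ((‖v - w‖)⁻¹ • (v - w)) (σ : V))) :=
              mb.comp (by fun_prop)
            rw [lintegral_mul_const _ m1,
              lintegral_inner_surfaceMeasure mb hunit]
        _ = ENNReal.ofReal (I.toReal * (2 * n) ^ γ) := by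
            rw [ENNReal.ofReal_mul (by positivity), ENNReal.ofReal_toReal hItop]
        _ ≤ _ := ENNReal.ofReal_le_ofReal (by linarith)

end

end InelasticBoltzmann

namespace InelasticBoltzmann

open ProbabilityTheory
open scoped ENNReal

/-! ### The solution of the cutoff inelastic Boltzmann equation -/

theorem IsTestFunction.comp_inner {f : ℝ → ℝ} (hf : ContDiff ℝ 2 f)
    (hb : ∀ k : ℕ, k ≤ 2 → ∀ x, |iteratedDeriv k f x| ≤ 1) (ξ : V) :
    IsTestFunction fun x => f (inner ℝ x ξ) := by
  have hL : (fun x : V => f (inner ℝ x ξ)) = f ∘ innerSL ℝ ξ := by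
    funext x
    simp [real_inner_comm]
  rw [hL]
  refine ⟨hf.comp (innerSL ℝ ξ).contDiff, fun k hk => ⟨∏ _i : Fin k, ‖innerSL ℝ ξ‖, fun v => ?_⟩⟩
  rw [(innerSL ℝ ξ).iteratedFDeriv_comp_right hf v (by exact_mod_cast hk)]
  refine (ContinuousMultilinearMap.norm_compContinuousLinearMap_le _ _).trans ?_
  rw [norm_iteratedFDeriv_eq_norm_iteratedDeriv]
  exact mul_le_of_le_one_left (Finset.prod_nonneg fun _ _ => norm_nonneg _) (hb k hk _)

theorem isTestFunction_cos_inner (ξ : V) : IsTestFunction fun x => Real.cos (inner ℝ x ξ) :=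
  IsTestFunction.comp_inner Real.contDiff_cos (fun k _ x => Real.abs_iteratedDeriv_cos_le_one k x) ξ

theorem isTestFunction_sin_inner (ξ : V) : IsTestFunction fun x => Real.sin (inner ℝ x ξ) :=
  IsTestFunction.comp_inner Real.contDiff_sin (fun k _ x => Real.abs_iteratedDeriv_sin_le_one k x) ξ

theorem IsTestFunction.exists_abs_le {ψ : V → ℝ} (hψ : IsTestFunction ψ) :
    ∃ C, ∀ v, |ψ v| ≤ C := by
  obtain ⟨C, hC⟩ := hψ.bounded 0 (by norm_num)
  exact ⟨C, fun v => by simpa using hC v⟩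

theorem sqrt_one_add_sq_rpow_le {α : ℝ} (h0 : 0 < α) (h2 : α ≤ 2) (v : V) :
    Real.sqrt (1 + ‖v‖ ^ 2) ^ α ≤ 1 + ‖v‖ ^ α := by
  rw [Real.sqrt_eq_rpow, ← Real.rpow_mul (by positivity)]
  refine (Real.rpow_add_le_add_rpow zero_le_one (sq_nonneg ‖v‖) (by positivity)
    (by linarith)).trans (le_of_eq ?_)
  rw [Real.one_rpow, ← Real.rpow_natCast, ← Real.rpow_mul (norm_nonneg v)]
  congr 2
  push_cast
  ring

theorem rpow_le_one_add_rpow {α β r : ℝ} (hr : 0 ≤ r) (hα : 0 ≤ α) (hαβ : α ≤ β) :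
    r ^ α ≤ 1 + r ^ β := by
  rcases le_total r 1 with h | h
  · have := Real.rpow_le_one hr h hα
    have := Real.rpow_nonneg hr β
    linarith
  · have := Real.rpow_le_rpow_of_exponent_le h hαβ
    linarith

theorem enorm_le_ofReal {x c : ℝ} (h : |x| ≤ c) : ‖x‖ₑ ≤ ENNReal.ofReal c := by
  rw [← ofReal_norm]
  exact ENNReal.ofReal_le_ofReal h

/-- A path of probability measures as a Markov kernel from time; negative times are sent to
`0`. -/
theorem IsContinuousPath.exists_kernel {α : ℝ} {F : ℝ → Measure V} (h0 : 0 < α)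
    (hF : IsContinuousPath α F) :
    ∃ K : Kernel ℝ V, IsMarkovKernel K ∧ ∀ t, 0 ≤ t → K t = F t := by
  have hp : ∀ t : ℝ, IsProbabilityMeasure (F (max t 0)) := fun t =>
    (hF.mem _ (le_max_right _ _)).isProbabilityMeasure
  have hm : Measurable fun t : ℝ => F (max t 0) := by
    refine measurable_of_continuous_integral fun f => ?_
    refine (hF.continuousOn f f.continuous ⟨‖f‖, fun v => ?_⟩).comp_continuous (by fun_prop)
      fun t => le_max_right t 0
    refine (f.norm_coe_le_norm v).trans (le_mul_of_one_le_right (norm_nonneg f) ?_)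
    exact Real.one_le_rpow (Real.one_le_sqrt.2 (by nlinarith [sq_nonneg ‖v‖])) h0.le
  exact ⟨⟨_, hm⟩, ⟨hp⟩, fun t ht => by
    change F (max t 0) = F t
    rw [max_eq_left ht]⟩

namespace HasRateBound

variable {e : ℝ} {B : V → V → V → ℝ} {M : ℝ} (hB : HasRateBound B M) {F₀ : Measure V}
  {α α₀ : ℝ}
include hB

theorem solvesIntegrated_of_isMeasureSolution {F : ℝ → Measure V}
    (hF₀ : IsProbabilityMeasure F₀) (hF : IsMeasureSolution e B α F₀ F) {K : Kernel ℝ V}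
    (hK : IsMarkovKernel K) (hKF : ∀ t, 0 ≤ t → K t = F t) :
    SolvesIntegrated (hB.kernel e) M F₀ K := by
  have := hB.isMarkovKernel_kernel (e := e)
  refine solvesIntegrated_of_cos_sin hB.pos.le fun g hg t ht => ?_
  have hg' : IsTestFunction g := by
    rcases hg with ⟨ξ, rfl | rfl⟩
    exacts [isTestFunction_cos_inner ξ, isTestFunction_sin_inner ξ]
  obtain ⟨C, hC⟩ := hg'.exists_abs_le
  rw [hKF t ht, hF.weak g hg' t ht]
  refine intervalIntegral.integral_congr fun τ hτ => ?_
  rw [uIcc_of_le ht] at hτ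
  rw [← hKF τ hτ.1, hB.weakCollision_eq hg'.contDiff.continuous.measurable hC]

theorem eq_of_isMeasureSolution (h0 : 0 < α) {F G : ℝ → Measure V}
    (hF : IsMeasureSolution e B α F₀ F) (hG : IsMeasureSolution e B α F₀ G) {t : ℝ}
    (ht : 0 ≤ t) : G t = F t := by
  have := hB.isMarkovKernel_kernel (e := e)
  have hF₀ : IsProbabilityMeasure F₀ := by
    rw [← hF.initial]
    exact (hF.path.mem 0 le_rfl).isProbabilityMeasure
  obtain ⟨K, hK, hKF⟩ := hF.path.exists_kernel h0
  obtain ⟨L, hL, hLG⟩ := hG.path.exists_kernel h0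
  rw [← hKF t ht, ← hLG t ht]
  exact (hB.solvesIntegrated_of_isMeasureSolution hF₀ hG hL hLG).unique
    (hB.solvesIntegrated_of_isMeasureSolution hF₀ hF hK hKF) hB.pos.le ht

theorem integral_coord_wildSum (he0 : 0 < e) (he1 : e ≤ 1) {β : ℝ} (hβ : 1 ≤ β)
    [IsProbabilityMeasure F₀] (hF₀ : Integrable (fun v : V => ‖v‖ ^ β) F₀) {t : ℝ} (ht : 0 ≤ t)
    (j : Fin 3) :
    Integrable (fun v : V => v j) (wildSum (hB.kernel e) M F₀ t) ∧
      ∫ v : V, v j ∂wildSum (hB.kernel e) M F₀ t = ∫ v : V, v j ∂F₀ := by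
  have := hB.isMarkovKernel_kernel (e := e)
  have h1 : Integrable (fun v : V => ‖v‖ ^ (1 : ℝ)) F₀ :=
    have hm : Measurable fun v : V => ‖v‖ ^ (1 : ℝ) := by fun_prop
    ((integrable_const 1).add hF₀).mono' hm.aestronglyMeasurable (Filter.Eventually.of_forall fun v => by
      rw [Real.norm_of_nonneg (by positivity)]
      exact rpow_le_one_add_rpow (norm_nonneg v) zero_le_one hβ)
  have hp := hB.isMomentWeight he0 he1 one_pos one_le_two h1 1
  have hj : ∀ v : V, ‖v j‖ₑ ≤ ENNReal.ofReal (1 * (1 + ‖v‖ ^ (1 : ℝ))) := fun v => by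
    refine enorm_le_ofReal ((PiLp.norm_apply_le v j).trans ?_)
    rw [Real.rpow_one]
    linarith
  have hm : Measurable fun v : V => v j := by fun_prop
  exact ⟨hp.integrable_wildSum hm hj hB.pos.le ht, hp.integral_wildSum_eq hm hj hB.pos.le ht
    (hB.integral_coord_kernel he0 he1 j)⟩

theorem isMeasureSolution_wildSum (he0 : 0 < e) (he1 : e ≤ 1) (h0 : 0 < α) (hα : α ≤ α₀)
    (h2 : α₀ ≤ 2) (hF₀ : MemP α₀ F₀) :
    IsMeasureSolution e B α F₀ (wildSum (hB.kernel e) M F₀) := by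
  have := hB.isMarkovKernel_kernel (e := e)
  have := hF₀.isProbabilityMeasure
  have hw := hB.isMomentWeight he0 he1 (h0.trans_le hα) h2 hF₀.moment
  have hprob : ∀ t, 0 ≤ t → IsProbabilityMeasure (wildSum (hB.kernel e) M F₀ t) := fun t ht =>
    isProbabilityMeasure_wildSum hB.pos.le ht
  refine ⟨⟨fun t ht => ⟨hprob t ht, ?_, fun h1 j => ?_⟩, fun ψ hψ ⟨C, hC⟩ => ?_⟩, wildSum_zero,
    fun ψ hψ t ht => ?_⟩
  · refine (hw 1).integrable_wildSum (by fun_prop) (fun v => enorm_le_ofReal ?_) hB.pos.le ht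
    rw [one_mul, abs_of_nonneg (by positivity)]
    exact rpow_le_one_add_rpow (norm_nonneg v) h0.le hα
  · rw [(hB.integral_coord_wildSum he0 he1 (h1.le.trans hα) hF₀.moment ht j).2]
    exact hF₀.centred (h1.trans_le hα) j
  · refine (hw C).continuousOn_integral_wildSum hψ.measurable (fun v => enorm_le_ofReal ?_)
      hB.pos.le
    have hC0 : 0 ≤ C := by simpa using (abs_nonneg _).trans (hC 0)
    refine (hC v).trans (mul_le_mul_of_nonneg_left ?_ hC0)
    refine le_trans ?_ (sqrt_one_add_sq_rpow_le (h0.trans_le hα) h2 v)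
    exact Real.rpow_le_rpow_of_exponent_le
      (Real.one_le_sqrt.2 (by nlinarith [sq_nonneg ‖v‖])) hα
  · obtain ⟨C, hC⟩ := hψ.exists_abs_le
    have hψm := hψ.contDiff.continuous.measurable
    rw [(isMomentWeight_const (κ := hB.kernel e) (μ := F₀) ENNReal.ofReal_ne_top).integral_wildSum_sub
      hψm (fun v => enorm_le_ofReal (hC v)) hB.pos.le ht]
    refine intervalIntegral.integral_congr fun τ hτ => ?_
    rw [uIcc_of_le ht] at hτ
    have := hprob τ hτ.1
    exact (hB.weakCollision_eq hψm hC).symm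

theorem energy_wildSum (he0 : 0 < e) (he1 : e ≤ 1) (hF₀ : MemP 2 F₀) :
    (∀ t, 0 ≤ t → Integrable (fun v : V => ‖v‖ ^ 2) (wildSum (hB.kernel e) M F₀ t)) ∧
      AntitoneOn (fun t => ∫ v : V, ‖v‖ ^ 2 ∂wildSum (hB.kernel e) M F₀ t) (Ici 0) := by
  have := hB.isMarkovKernel_kernel (e := e)
  have := hF₀.isProbabilityMeasure
  have hw := hB.isMomentWeight he0 he1 two_pos le_rfl hF₀.moment 1
  have hle : ∀ v : V, ‖‖v‖ ^ 2‖ₑ ≤ ENNReal.ofReal (1 * (1 + ‖v‖ ^ (2 : ℝ))) := fun v => by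
    refine enorm_le_ofReal ?_
    rw [abs_of_nonneg (by positivity), Real.rpow_two]
    linarith
  have hm : Measurable fun v : V => ‖v‖ ^ 2 := by fun_prop
  refine ⟨fun t ht => hw.integrable_wildSum hm hle hB.pos.le ht,
    hw.antitoneOn_integral_wildSum hm hle hB.pos.le (fun v => by positivity) fun q => ?_⟩
  have h := hB.lintegral_kernel_le (e := e) (p := fun v => ENNReal.ofReal (‖v‖ ^ 2))
    (by fun_prop) (c := 1) le_rfl (fun v w σ => ?_) q
  · rwa [mul_one] at h
  · rw [one_mul, ← ENNReal.ofReal_add (by positivity) (by positivity),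
      ← ENNReal.ofReal_add (by positivity) (by positivity)]
    exact ENNReal.ofReal_le_ofReal
      (norm_sq_postV_add_norm_sq_postW_le he0 he1 (mem_sphere_zero_iff_norm.1 σ.2))

end HasRateBound

end InelasticBoltzmann

theorem proposition3p3
    (e : ℝ) (he0 : 0 < e) (he1 : e ≤ 1)
    (γ : ℝ) (hγ0 : 0 < γ) (hγ2 : γ ≤ 2)
    (n : ℕ) (hn : 1 ≤ n)
    (bn : ℝ → ℝ) (hbn : InelasticBoltzmann.IsCutoffAngularKernel bn)
    (φ : ℝ → ℝ) (hφ : InelasticBoltzmann.IsCutoffProfile φ)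
    (B : InelasticBoltzmann.V → InelasticBoltzmann.V → InelasticBoltzmann.V → ℝ)
    (hB : B = InelasticBoltzmann.collisionKernel bn (InelasticBoltzmann.kineticKernel γ φ n))
    (α₀ : ℝ) (hα₀ : α₀ ∈ Set.Ioc (0 : ℝ) 2)
    (F₀ : MeasureTheory.Measure InelasticBoltzmann.V) (hF₀ : InelasticBoltzmann.MemP α₀ F₀) :
    ∃ F : ℝ → MeasureTheory.Measure InelasticBoltzmann.V,
      -- existence, with the same solution for all `α < α₀`
      (∀ α ∈ Set.Ioo (0 : ℝ) α₀, InelasticBoltzmann.IsMeasureSolution e B α F₀ F) ∧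
      -- uniqueness in each class `C([0,∞), P_α)`
      (∀ α ∈ Set.Ioo (0 : ℝ) α₀, ∀ G : ℝ → MeasureTheory.Measure InelasticBoltzmann.V,
        InelasticBoltzmann.IsMeasureSolution e B α F₀ G → ∀ t : ℝ, 0 ≤ t → G t = F t) ∧
      -- the energy is finite and non-increasing
      (InelasticBoltzmann.MemP 2 F₀ →
        (∀ t : ℝ, 0 ≤ t →
          MeasureTheory.Integrable (fun v : InelasticBoltzmann.V => ‖v‖ ^ 2) (F t)) ∧
        ∀ s t : ℝ, 0 ≤ s → s ≤ t →
          ∫ v : InelasticBoltzmann.V, ‖v‖ ^ 2 ∂(F t) ≤ ∫ v : InelasticBoltzmann.V, ‖v‖ ^ 2 ∂(F s)) ∧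
      -- conservation of momentum
      (∀ β : ℝ, 1 ≤ β → InelasticBoltzmann.MemP β F₀ →
        ∀ t : ℝ, 0 ≤ t → ∀ j : Fin 3,
          MeasureTheory.Integrable (fun v : InelasticBoltzmann.V => v j) (F t) ∧
          ∫ v : InelasticBoltzmann.V, v j ∂(F t) = ∫ v : InelasticBoltzmann.V, v j ∂F₀) := by
  obtain ⟨M, hM⟩ := InelasticBoltzmann.exists_hasRateBound hγ0 hn hbn hφ
  rw [← hB] at hM
  have hsol : ∀ α ∈ Set.Ioo (0 : ℝ) α₀, InelasticBoltzmann.IsMeasureSolution e B α F₀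
      (InelasticBoltzmann.wildSum (hM.kernel e) M F₀) := fun α hα =>
    hM.isMeasureSolution_wildSum he0 he1 hα.1 hα.2.le hα₀.2 hF₀
  refine ⟨InelasticBoltzmann.wildSum (hM.kernel e) M F₀, hsol,
    fun α hα G hG t ht => hM.eq_of_isMeasureSolution hα.1 (hsol α hα) hG ht, fun h2 => ?_,
    fun β hβ hFβ t ht j => ?_⟩
  · obtain ⟨hi, ha⟩ := hM.energy_wildSum he0 he1 h2
    exact ⟨hi, fun s t hs hst => ha hs (hs.trans hst) hst⟩
  · have := hFβ.isProbabilityMeasure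
    exact hM.integral_coord_wildSum he0 he1 hβ hFβ.moment ht j
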